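/- Let $K$ be a locally compact, separable, metrizable space and $\mu$ a $\sigma$-finite Borel measure on $K$ with full support. Let $(\mathcal E,\mathcal F)$ and $(\tilde{\mathcal E},\tilde{\mathcal F})$ be two symmetric regular Dirichlet forms on the real space $L^2(K,\mu)$, both strong local: $\mathcal E(f,g)=0$ whenever $f,g\in\mathcal F$ have compact supports and $g$ is constant on a neighbourhood of $\operatorname{supp} f$ (and likewise for $\tilde{\mathcal E}$), where $\operatorname{supp} f$ is the support of the measure $|f|\cdot\mu$. For $f\in\mathcal F$ let $\nu_f$ be the energy measure of $f$: for bounded $f$ it is the finite Borel measure with $\int_K\varphi\,d\nu_f=2\mathcal E(f\varphi,f)-\mathcal E(\varphi,f^2)$ for all $\varphi\in\mathcal F\cap C_0(K)$, where $C_0(K)$ denotes the continuous functions with compact support; for general $f$ it is the setwise limit of $\nu_{f_n}$ for bounded $f_n\in\mathcal F$ with $f_n\to f$ in the norm $(\mathcal E(\cdot,\cdot)+\|\cdot\|_{L^2}^2)^{1/2}$. Put $\nu_{f,g}=\frac12(\nu_{f+g}-\nu_f-\nu_g)$. A $\sigma$-finite Borel measure $\nu$ on $K$ is a minimal energy-dominant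 measure of $(\mathcal E,\mathcal F)$ if $\nu_f\ll\nu$ for all $f\in\mathcal F$, and $\nu\ll\nu'$ for every $\sigma$-finite Borel measure $\nu'$ such that $\nu_f\ll\nu'$ for all $f\in\mathcal F$. Given such a $\nu$, a pointwise index of $(\mathcal E,\mathcal F)$ is a measurable function $p\colon K\to\{0,1,2,\dots\}\cup\{+\infty\}$ such that (a) for all $N$ and all $f_1,\dots,f_N\in\mathcal F$, $\operatorname{rank}\bigl(\tfrac{d\nu_{f_i,f_j}}{d\nu}(x)\bigr)_{i,j=1}^N\le p(x)$ for $\nu$-a.e. $x$; (b) if another function $p'$ with values in $\{0,1,2,\dots\}\cup\{+\infty\}$ satisfies (a) with $p$ replaced by $p'$, then $p\le p'$ $\nu$-a.e. The same notions are defined for $(\tilde{\mathcal E},\tilde{\mathcal F})$. **Proposition.** Suppose that $\mathcal F=\tilde{\mathcal F}$ and that there are constants $c_1,c_2>0$ with $$c_1\,\mathcal E(f,f)\le\tilde{\mathcal E}(f,f)\le c_2\,\mathcal E(f,f)\qquad\text{for all } f\in\mathcal F .$$ Let $\nu$ be a minimal energy-dominant measure of $(\mathcal E,\mathcal F)$.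 Then $\nu$ is also a minimal energy-dominant measure of $(\tilde{\mathcal E},\tilde{\mathcal F})$, and the pointwise indices of $(\mathcal E,\mathcal F)$ and $(\tilde{\mathcal E},\tilde{\mathcal F})$ with respect to $\nu$ exist and coincide $\nu$-a.e.: some function is a pointwise index of both forms, and any pointwise index of the first equals any pointwise index of the second $\nu$-a.e. -/

import Mathlib

open MeasureTheory Filter Topology
open scoped CompactlySupported

noncomputable section

/-- A symmetric Dirichlet form `(form, domain)` on the real Hilbert space `L²(K, μ)`. -/
structure DirichletForm {K : Type*} [MeasurableSpace K] (μ : Measure K) where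
  /-- The domain `F`, a linear subspace of `L²(K, μ)`. -/
  domain : Submodule ℝ (Lp ℝ 2 μ)
  /-- The bilinear form on the domain. -/
  form : domain →ₗ[ℝ] domain →ₗ[ℝ] ℝ
  dense_domain : Dense (domain : Set (Lp ℝ 2 μ))
  symm : ∀ f g : domain, form f g = form g f
  nonneg : ∀ f : domain, 0 ≤ form f f
  /-- Every sequence that is Cauchy for `form f f + ‖f‖²` converges in the domain. -/
  closed : ∀ f : ℕ → domain,
    (∀ ε > 0, ∃ n : ℕ, ∀ i ≥ n, ∀ j > i,
      form (f i - f j) (f i - f j) +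
        inner ℝ ((f i - f j : domain) : Lp ℝ 2 μ) ((f i - f j : domain) : Lp ℝ 2 μ) < ε) →
    ∃ g : domain, Tendsto (fun i => form (f i - g) (f i - g) +
        inner ℝ ((f i - g : domain) : Lp ℝ 2 μ) ((f i - g : domain) : Lp ℝ 2 μ)) atTop (𝓝 0)
  /-- The unit contraction `min (max 0 f) 1` operates on the form. -/
  markov : ∀ f : domain, ∃ g : domain,
    ((g : Lp ℝ 2 μ) : K → ℝ) =ᵐ[μ] (fun x => min (max 0 ((f : Lp ℝ 2 μ) x)) 1) ∧
      form g g ≤ form f f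

namespace DirichletForm

section Basic

variable {K : Type*} [MeasurableSpace K] {μ : Measure K} (E : DirichletForm μ)

/-- `E₁(f, g) = E(f, g) + ∫ f g dμ`, the inner product of the domain. -/
def form₁ (f g : E.domain) : ℝ := E.form f g + inner ℝ (f : Lp ℝ 2 μ) (g : Lp ℝ 2 μ)

/-- `f` is an element of the domain that belongs to `L^∞(K, μ)`. -/
def IsBdd (f : E.domain) : Prop := ∃ C : ℝ, ∀ᵐ x ∂μ, |(f : Lp ℝ 2 μ) x| ≤ C

end Basic

section Topological

variable {K : Type*} [TopologicalSpace K] [MeasurableSpace K] {μ : Measure K}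
  (E : DirichletForm μ)

/-- Regularity: `F ∩ C₀(K)` (classes in `F` with a continuous, compactly supported representative)
is dense in `F` for the norm of `E₁`, and uniformly dense in `C₀(K)`. -/
structure IsRegular : Prop where
  dense_in_domain : ∀ f : E.domain, ∀ ε > 0, ∃ (g : E.domain) (φ : C_c(K, ℝ)),
    ((g : Lp ℝ 2 μ) : K → ℝ) =ᵐ[μ] φ ∧ E.form₁ (f - g) (f - g) < ε
  dense_uniform : ∀ φ : C_c(K, ℝ), ∀ ε > 0, ∃ (g : E.domain) (ψ : C_c(K, ℝ)),
    ((g : Lp ℝ 2 μ) : K → ℝ) =ᵐ[μ] ψ ∧ ∀ x, |φ x - ψ x| < ε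

/-- The support of `f`, that is, the topological support of the measure `|f| · μ`. -/
def supp (f : E.domain) : Set K := (μ.withDensity fun x => ‖(f : Lp ℝ 2 μ) x‖ₑ).support

/-- Strong locality: `E(f, g) = 0` whenever `supp f` and `supp g` are compact and `g` is
(almost everywhere) constant on a neighbourhood of `supp f`. -/
def IsStrongLocal : Prop :=
  ∀ f g : E.domain, IsCompact (E.supp f) → IsCompact (E.supp g) →
    (∃ (U : Set K) (c : ℝ), IsOpen U ∧ E.supp f ⊆ U ∧
      ∀ᵐ x ∂μ, x ∈ U → (g : Lp ℝ 2 μ) x = c) →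
    E.form f g = 0

/-- `m` is the energy measure of the bounded element `f` of the domain: `m` is finite and
`∫ φ dm = 2 E(f φ, f) - E(φ, f²)` for all `φ ∈ F ∩ C₀(K)`. Here `u = f φ` and `v = f²` as
elements of the domain. -/
def IsBddEnergyMeasure (f : E.domain) (m : Measure K) : Prop :=
  IsFiniteMeasure m ∧
    ∀ (φ : C_c(K, ℝ)) (g : E.domain), ((g : Lp ℝ 2 μ) : K → ℝ) =ᵐ[μ] φ →
      ∃ u v : E.domain,
        ((u : Lp ℝ 2 μ) : K → ℝ) =ᵐ[μ] (fun x => (f : Lp ℝ 2 μ) x * φ x) ∧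
        ((v : Lp ℝ 2 μ) : K → ℝ) =ᵐ[μ] (fun x => (f : Lp ℝ 2 μ) x ^ 2) ∧
        ∫ x, φ x ∂m = 2 * E.form u f - E.form g v

/-- `m` is the energy measure of `f`: it is the setwise limit of the energy measures of bounded
elements `f n` of the domain that converge to `f` in the norm of `E₁`. -/
def IsEnergyMeasure (f : E.domain) (m : Measure K) : Prop :=
  IsFiniteMeasure m ∧
    ∃ (g : ℕ → E.domain) (ν : ℕ → Measure K),
      (∀ n, E.IsBdd (g n)) ∧ (∀ n, E.IsBddEnergyMeasure (g n) (ν n)) ∧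
      Tendsto (fun n => E.form₁ (g n - f) (g n - f)) atTop (𝓝 0) ∧
      ∀ B : Set K, MeasurableSet B → Tendsto (fun n => ν n B) atTop (𝓝 (m B))

open Classical in
/-- The energy measure `ν_f`. For a regular Dirichlet form it exists and is unique; the value `0`
in the other case is never used. -/
def energyMeasure (f : E.domain) : Measure K :=
  if h : ∃ m, E.IsEnergyMeasure f m then h.choose else 0

instance (f : E.domain) : IsFiniteMeasure (E.energyMeasure f) := by
  unfold energyMeasure
  split_ifs with h
  · exact h.choose_spec.1
  · infer_instance

/-- The mutual energy measure `ν_{f,g} = (ν_{f+g} - ν_f - ν_g) / 2`, a signed measure. -/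
def mutualEnergyMeasure (f g : E.domain) : SignedMeasure K :=
  (1 / 2 : ℝ) • ((E.energyMeasure (f + g)).toSignedMeasure
    - (E.energyMeasure f).toSignedMeasure - (E.energyMeasure g).toSignedMeasure)

/-- `ν` is a minimal energy-dominant measure of `E`. -/
structure IsMinimalEnergyDominant (ν : Measure K) : Prop where
  sigmaFinite : SigmaFinite ν
  domination : ∀ f : E.domain, E.energyMeasure f ≪ ν
  minimality : ∀ ν' : Measure K, SigmaFinite ν' →
    (∀ f : E.domain, E.energyMeasure f ≪ ν') → ν ≪ ν'

/-- The matrix `(dν_{f i, f j} / dν (x))_{i,j}` of Radon-Nikodym derivatives. -/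
def densityMatrix (ν : Measure K) {N : ℕ} (f : Fin N → E.domain) (x : K) :
    Matrix (Fin N) (Fin N) ℝ :=
  Matrix.of fun i j => (E.mutualEnergyMeasure (f i) (f j)).rnDeriv ν x

/-- For all `f₁, …, f_N` in the domain, the rank of the density matrix is at most `p`,
`ν`-almost everywhere. -/
def BoundsRank (ν : Measure K) (p : K → ℕ∞) : Prop :=
  ∀ (N : ℕ) (f : Fin N → E.domain), ∀ᵐ x ∂ν, ((E.densityMatrix ν f x).rank : ℕ∞) ≤ p x

/-- `p` is (a version of) the pointwise index of `E`, where `ν` is the fixed minimal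
energy-dominant measure: the smallest measurable function that bounds the ranks of the density
matrices. -/
structure IsPointwiseIndex (ν : Measure K) (p : K → ℕ∞) : Prop where
  measurable : Measurable p
  boundsRank : E.BoundsRank ν p
  le_of_boundsRank : ∀ p' : K → ℕ∞, E.BoundsRank ν p' → p ≤ᵐ[ν] p'

end Topological

end DirichletForm

end

set_option linter.unusedSectionVars false

/-! Everything follows from the comparison of energy measures, c₁ ν_f ≤ ν'_f ≤ c₂ ν_f, where a prime
refers to the second form (`energyMeasure_real_le`). It makes ν_f and ν'_f mutually absolutely
continuous, so the two forms have the same minimal energy-dominant measures. It also makes the two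
density matrices comparable as positive semidefinite matrices at ν-almost every point, so their
kernels agree and their ranks are equal.

The comparison comes from testing the inequality between the forms on fast oscillations. For φ ≥ 0
and f in F ∩ C₀(K), strong locality gives E(φ cos lf, φ cos lf) + E(φ sin lf, φ sin lf) = E(φ, φ) +
(l²/2) ∫ φ² dν_f (`trig_identity`, `energyFunctional_sq`). Comparing the forms on these functions
and letting l tend to infinity leaves ∫ φ² dν'_f ≤ c₂ ∫ φ² dν_f. The other bound follows by
exchanging the forms, and density of F ∩ C₀(K) in F extends both to all f.

No chain rule for energy measures is developed. Its substitute is `two_point`, used mostly through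
`IsKernel.nonpos`: if a kernel ∑ aᵢ(x) bᵢ(y) is nonnegative and vanishes on the diagonal, then ∑
E(aᵢ, bᵢ) ≤ 0. This holds for the approximating forms β(u - βG_β u, v) because βG_β is symmetric and
sub-Markovian, and it survives the limit β → ∞. Strong locality gives ψ(x)ψ(y)(f(x) - f(y))⁴ the
value 0 (`quartic_eq_zero`), so kernels need to agree only up to fourth order in the differences, as
1 - cos t and t²/2 do.

Existence of the energy measures has to be proved, since `energyMeasure` is 0 by default. For
bounded f it is a Riesz representation. For general f it rests on √ν_f(B) being Lipschitz in f for
the energy seminorm, uniformly in B. The pointwise index is the essential supremum of the ranks. -/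

noncomputable section
namespace DirichletForm

/-! ### The domain as a Hilbert space, weak compactness and the resolvent -/

section Hilbert

variable {K : Type*} [MeasurableSpace K] {μ : Measure K} (E : DirichletForm μ)

/-- The domain of `E`, as a type on which `E(f, g) + β (f, g)` will be the inner product. -/
def Hilb (E : DirichletForm μ) (_β : ℝ) : Type _ := E.domain

instance (β : ℝ) : AddCommGroup (E.Hilb β) := inferInstanceAs (AddCommGroup E.domain)
instance (β : ℝ) : Module ℝ (E.Hilb β) := inferInstanceAs (Module ℝ E.domain)

/-- The identification of `E.Hilb β` with the domain. -/
def toDom (β : ℝ) : E.Hilb β ≃ₗ[ℝ] E.domain := LinearEquiv.refl ℝ E.domain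

theorem form_self_add_nonneg {β : ℝ} (hβ : 0 < β) (x : E.domain) :
    0 ≤ E.form x x + β * inner ℝ (x : Lp ℝ 2 μ) (x : Lp ℝ 2 μ) :=
  add_nonneg (E.nonneg x) (mul_nonneg hβ.le real_inner_self_nonneg)

variable (β : ℝ) [hβ : Fact (0 < β)]

/-- The inner product `E(f, g) + β (f, g)`. -/
abbrev hilbCore : InnerProductSpace.Core ℝ (E.Hilb β) where
  inner x y := E.form (E.toDom β x) (E.toDom β y) +
    β * inner ℝ (E.toDom β x : Lp ℝ 2 μ) (E.toDom β y : Lp ℝ 2 μ)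
  conj_inner_symm x y := by
    simp only [conj_trivial]
    rw [E.symm, real_inner_comm]
  re_inner_nonneg x := by
    simpa using E.form_self_add_nonneg hβ.out (E.toDom β x)
  add_left x y z := by
    simp only [map_add, LinearMap.add_apply, Submodule.coe_add, inner_add_left]
    ring
  smul_left x y r := by
    simp only [map_smul, LinearMap.smul_apply, Submodule.coe_smul, inner_smul_left, smul_eq_mul,
      conj_trivial]
    ring
  definite x h := by
    have h1 := E.nonneg (E.toDom β x)
    have h2 : 0 ≤ inner ℝ (E.toDom β x : Lp ℝ 2 μ) (E.toDom β x : Lp ℝ 2 μ) :=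
      real_inner_self_nonneg
    have h3 := hβ.out
    have h4 : inner ℝ (E.toDom β x : Lp ℝ 2 μ) (E.toDom β x : Lp ℝ 2 μ) = 0 := by
      by_contra hne
      have := mul_pos h3 (lt_of_le_of_ne h2 (Ne.symm hne))
      linarith
    exact (E.toDom β).map_eq_zero_iff.mp (Subtype.ext (inner_self_eq_zero.mp h4))

instance : NormedAddCommGroup (E.Hilb β) := (E.hilbCore β).toNormedAddCommGroup
instance : InnerProductSpace ℝ (E.Hilb β) := InnerProductSpace.ofCore (E.hilbCore β).toCore

theorem hilb_inner (x y : E.Hilb β) : inner ℝ x y = E.form (E.toDom β x) (E.toDom β y) +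
    β * inner ℝ (E.toDom β x : Lp ℝ 2 μ) (E.toDom β y : Lp ℝ 2 μ) := rfl

theorem hilb_norm_sq (x : E.Hilb β) : ‖x‖ ^ 2 = E.form (E.toDom β x) (E.toDom β x) +
    β * ‖(E.toDom β x : Lp ℝ 2 μ)‖ ^ 2 := by
  rw [← real_inner_self_eq_norm_sq, ← real_inner_self_eq_norm_sq, hilb_inner]

instance : CompleteSpace (E.Hilb β) := by
  have hb := hβ.out
  refine Metric.complete_of_cauchySeq_tendsto fun u hu => ?_
  obtain ⟨g, hg⟩ := E.closed (fun i => E.toDom β (u i)) (by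
    intro ε hε
    -- The norm in `closed` has weight 1 on the L² part. The bound E + ‖·‖² ≤ (1 + β⁻¹)(E + β‖·‖²)
    -- passes to it, and the factor 1 + β serves for the way back.
    have hδ : 0 < Real.sqrt (ε / (1 + β⁻¹)) := Real.sqrt_pos.mpr (by positivity)
    obtain ⟨n, hn⟩ := Metric.cauchySeq_iff.mp hu _ hδ
    refine ⟨n, fun i hi j hj => ?_⟩
    have h1 := hn i hi j (hi.trans hj.le)
    rw [dist_eq_norm] at h1
    have h2 := (Real.lt_sqrt (norm_nonneg _)).mp h1
    rw [hilb_norm_sq, map_sub, lt_div_iff₀ (by positivity)] at h2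
    refine lt_of_le_of_lt ?_ h2
    rw [real_inner_self_eq_norm_sq]
    have h5 := E.nonneg (E.toDom β (u i) - E.toDom β (u j))
    generalize E.form _ _ = a at *
    have : (a + β * ‖((E.toDom β (u i) - E.toDom β (u j) : E.domain) : Lp ℝ 2 μ)‖ ^ 2) *
      (1 + β⁻¹) = a + ‖((E.toDom β (u i) - E.toDom β (u j) : E.domain) : Lp ℝ 2 μ)‖ ^ 2 +
        (a * β⁻¹ + β * ‖((E.toDom β (u i) - E.toDom β (u j) : E.domain) : Lp ℝ 2 μ)‖ ^ 2) := by
      field_simp; ring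
    rw [this]
    exact le_add_of_nonneg_right (by positivity))
  refine ⟨(E.toDom β).symm g, ?_⟩
  rw [tendsto_iff_norm_sub_tendsto_zero]
  have h1 : Tendsto (fun i => ‖u i - (E.toDom β).symm g‖ ^ 2) atTop (𝓝 0) := by
    have h2 := hg.const_mul (1 + β)
    rw [mul_zero] at h2
    refine squeeze_zero (fun _ => by positivity) (fun i => ?_) h2
    rw [hilb_norm_sq, map_sub, LinearEquiv.apply_symm_apply, real_inner_self_eq_norm_sq]
    have h5 := E.nonneg (E.toDom β (u i) - g)
    nlinarith [sq_nonneg ‖((E.toDom β (u i) - g : E.domain) : Lp ℝ 2 μ)‖, mul_nonneg hb.le h5]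
  simpa using h1.sqrt

/-- The inclusion of the domain in `L²`. -/
def incl : E.Hilb β →L[ℝ] Lp ℝ 2 μ :=
  LinearMap.mkContinuous (E.domain.subtype ∘ₗ (E.toDom β).toLinearMap) (Real.sqrt β⁻¹) (by
    intro x
    have hb := hβ.out
    have h := E.hilb_norm_sq β x
    have h1 := E.nonneg (E.toDom β x)
    rw [← Real.sqrt_sq (norm_nonneg x), ← Real.sqrt_mul (by positivity)]
    refine Real.le_sqrt_of_sq_le ?_
    rw [h, mul_add, ← mul_assoc, inv_mul_cancel₀ hb.ne', one_mul]
    exact le_add_of_nonneg_left (by positivity))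

theorem incl_apply (x : E.Hilb β) : E.incl β x = (E.toDom β x : Lp ℝ 2 μ) := rfl

/-- The resolvent `u ↦ G_β u` with values in the domain. -/
def resolvent : Lp ℝ 2 μ →L[ℝ] E.Hilb β := (E.incl β).adjoint

theorem inner_resolvent (u : Lp ℝ 2 μ) (g : E.Hilb β) :
    inner ℝ (E.resolvent β u) g = inner ℝ u (E.toDom β g : Lp ℝ 2 μ) := by
  rw [resolvent, ContinuousLinearMap.adjoint_inner_left, incl_apply]

/-- A vector y orthogonal to the range satisfies 0 = ⟨G_β y, y⟩ = ‖y‖² in L². Pairing with a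
resolvent is an L² pairing, so for bounded sequences density upgrades L² convergence to weak
convergence in the domain. -/
theorem dense_resolvent (x : E.Hilb β) {ε : ℝ} (hε : 0 < ε) :
    ∃ h : Lp ℝ 2 μ, ‖x - E.resolvent β h‖ < ε := by
  have hd : (LinearMap.range (E.resolvent β).toLinearMap).topologicalClosure = ⊤ := by
    rw [Submodule.topologicalClosure_eq_top_iff, Submodule.eq_bot_iff]
    intro y hy
    have h1 := (Submodule.mem_orthogonal _ y).mp hy _ ⟨(E.toDom β y : Lp ℝ 2 μ), rfl⟩
    have h2 : inner ℝ (E.toDom β y : Lp ℝ 2 μ) (E.toDom β y : Lp ℝ 2 μ) = 0 := by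
      rw [← inner_resolvent]; exact h1
    exact (E.toDom β).map_eq_zero_iff.mp (Subtype.ext (inner_self_eq_zero.mp h2))
  have hx : x ∈ (LinearMap.range (E.resolvent β).toLinearMap).topologicalClosure := by
    rw [hd]; trivial
  rw [← SetLike.mem_coe, Submodule.topologicalClosure_coe, Metric.mem_closure_iff] at hx
  obtain ⟨_, ⟨h, rfl⟩, hh⟩ := hx ε hε
  exact ⟨h, by rwa [dist_eq_norm] at hh⟩

/-- Weak compactness: an `L²`-limit of a sequence of bounded energy lies in the domain, and the
sequence converges weakly in the domain. -/
theorem weak_limit (u : ℕ → E.domain) (v : Lp ℝ 2 μ) (C : ℝ)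
    (hu : Tendsto (fun n => (u n : Lp ℝ 2 μ)) atTop (𝓝 v)) (hC : ∀ n, E.form (u n) (u n) ≤ C) :
    ∃ w : E.domain, (w : Lp ℝ 2 μ) = v ∧ E.form w w ≤ C ∧
      ∀ g, Tendsto (fun n => E.form (u n) g) atTop (𝓝 (E.form w g)) := by
  have : Fact ((0 : ℝ) < 1) := ⟨one_pos⟩
  let x : ℕ → E.Hilb 1 := fun n => (E.toDom 1).symm (u n)
  obtain ⟨B, hB⟩ := hu.norm.bddAbove_range
  have hB' : ∀ n, ‖(u n : Lp ℝ 2 μ)‖ ≤ B := fun n => hB ⟨n, rfl⟩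
  have hx : ∀ n, ‖x n‖ ≤ Real.sqrt (C + B ^ 2) := fun n => by
    refine Real.le_sqrt_of_sq_le ?_
    rw [hilb_norm_sq, one_mul]
    simp only [x, LinearEquiv.apply_symm_apply]
    exact add_le_add (hC n) (pow_le_pow_left₀ (norm_nonneg _) (hB' n) 2)
  set S := Real.sqrt (C + B ^ 2)
  have hS : 0 ≤ S := Real.sqrt_nonneg _
  have hconv : ∀ y : E.Hilb 1, ∃ l, Tendsto (fun n => inner ℝ (x n) y) atTop (𝓝 l) := by
    intro y
    refine cauchySeq_tendsto_of_complete (Metric.cauchySeq_iff.mpr fun ε hε => ?_)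
    obtain ⟨h, hh⟩ := E.dense_resolvent 1 y (ε := ε / (3 * (S + 1))) (by positivity)
    have h1 : CauchySeq fun n => inner ℝ (x n) (E.resolvent 1 h) := by
      have h2 : (fun n => inner ℝ (x n) (E.resolvent 1 h)) =
          fun n => inner ℝ h (u n : Lp ℝ 2 μ) := by
        funext n
        rw [real_inner_comm, inner_resolvent]
        simp [x]
      rw [h2]
      exact (Filter.Tendsto.inner tendsto_const_nhds hu).cauchySeq
    obtain ⟨N, hN⟩ := Metric.cauchySeq_iff.mp h1 (ε / 3) (by positivity)
    refine ⟨N, fun m hm n hn => ?_⟩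
    have h3 := hN m hm n hn
    rw [Real.dist_eq] at h3 ⊢
    have h4 : ∀ k, |inner ℝ (x k) (y - E.resolvent 1 h)| < ε / 3 := fun k => by
      refine lt_of_le_of_lt (abs_real_inner_le_norm _ _) ?_
      calc ‖x k‖ * ‖y - E.resolvent 1 h‖ ≤ S * (ε / (3 * (S + 1))) :=
            mul_le_mul (hx k) hh.le (norm_nonneg _) hS
        _ < (S + 1) * (ε / (3 * (S + 1))) := by
            apply mul_lt_mul_of_pos_right (by linarith) (by positivity)
        _ = ε / 3 := by field_simp
    have h5 := h4 m
    have h6 := h4 n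
    rw [inner_sub_right] at h5 h6
    rw [abs_lt] at *
    constructor <;> linarith [h3.1, h3.2, h5.1, h5.2, h6.1, h6.2]
  choose l hl using hconv
  let L : E.Hilb 1 →ₗ[ℝ] ℝ :=
    { toFun := l
      map_add' := fun a b => tendsto_nhds_unique (hl (a + b)) (by
        simpa only [inner_add_right] using (hl a).add (hl b))
      map_smul' := fun r a => tendsto_nhds_unique (hl (r • a)) (by
        simpa only [inner_smul_right, smul_eq_mul, RingHom.id_apply] using (hl a).const_mul r) }
  let Lc : StrongDual ℝ (E.Hilb 1) := L.mkContinuous S (fun y => by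
    refine le_of_tendsto (hl y).norm (Eventually.of_forall fun n => ?_)
    exact (norm_inner_le_norm _ _).trans (mul_le_mul_of_nonneg_right (hx n) (norm_nonneg _)))
  let w := (InnerProductSpace.toDual ℝ (E.Hilb 1)).symm Lc
  have hw : ∀ y, Tendsto (fun n => inner ℝ (x n) y) atTop (𝓝 (inner ℝ w y)) := fun y => by
    have : inner ℝ w y = l y := by
      rw [InnerProductSpace.toDual_symm_apply]; rfl
    rw [this]; exact hl y
  have hwv : (E.toDom 1 w : Lp ℝ 2 μ) = v := by
    refine ext_inner_left ℝ fun h => ?_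
    rw [← inner_resolvent, real_inner_comm]
    refine tendsto_nhds_unique (hw (E.resolvent 1 h)) ?_
    have h2 : (fun n => inner ℝ (x n) (E.resolvent 1 h)) =
          fun n => inner ℝ h (u n : Lp ℝ 2 μ) := by
        funext n
        rw [real_inner_comm, inner_resolvent]
        simp [x]
    rw [h2]
    exact Filter.Tendsto.inner tendsto_const_nhds hu
  have hlim : ∀ g, Tendsto (fun n => E.form (u n) g) atTop (𝓝 (E.form (E.toDom 1 w) g)) := by
    intro g
    have h1 := (hw ((E.toDom 1).symm g)).sub
      (Filter.Tendsto.inner hu (tendsto_const_nhds (x := (g : Lp ℝ 2 μ))))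
    simpa [hilb_inner, x, hwv] using h1
  refine ⟨E.toDom 1 w, hwv, ?_, hlim⟩
  set z := E.toDom 1 w
  -- Lower semicontinuity: E(uₙ - z, uₙ - z) ≥ 0 gives 2 E(uₙ, z) - E(z, z) ≤ E(uₙ, uₙ) ≤ C, and the
  -- left side tends to E(z, z).
  have h1 : Tendsto (fun n => 2 * E.form (u n) z - E.form z z) atTop (𝓝 (E.form z z)) := by
    have := ((hlim z).const_mul 2).sub_const (E.form z z)
    simpa [two_mul] using this
  refine le_of_tendsto h1 (Eventually.of_forall fun n => ?_)
  have h2 := E.nonneg (u n - z)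
  simp only [map_sub, LinearMap.sub_apply] at h2
  have := E.symm (u n) z
  linarith [hC n]

/-- `β G_β` as an operator on `L²`. -/
def yosida : Lp ℝ 2 μ →L[ℝ] Lp ℝ 2 μ := β • ((E.incl β).comp (E.resolvent β))

/-- `β G_β u` as an element of the domain. -/
def yosidaDom (u : Lp ℝ 2 μ) : E.domain := β • E.toDom β (E.resolvent β u)

theorem yosidaDom_coe (u : Lp ℝ 2 μ) : (E.yosidaDom β u : Lp ℝ 2 μ) = E.yosida β u := rfl

/-- This is the resolvent equation E(G_β u, g) + β(G_β u, g) = (u, g). Its right side, read as a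
function of u and g in L², is the form that approximates E. -/
theorem form_yosidaDom (u : Lp ℝ 2 μ) (g : E.domain) :
    E.form (E.yosidaDom β u) g = β * inner ℝ (u - E.yosida β u) (g : Lp ℝ 2 μ) := by
  have h := E.inner_resolvent β u ((E.toDom β).symm g)
  rw [hilb_inner, LinearEquiv.apply_symm_apply] at h
  rw [inner_sub_left, ← h, ← yosidaDom_coe, yosidaDom]
  simp only [map_smul, LinearMap.smul_apply, Submodule.coe_smul, inner_smul_left, smul_eq_mul,
      conj_trivial]
  ring

theorem yosida_symm (u v : Lp ℝ 2 μ) :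
    inner ℝ (E.yosida β u) v = inner ℝ u (E.yosida β v) := by
  rw [← yosidaDom_coe, ← yosidaDom_coe, yosidaDom, yosidaDom, Submodule.coe_smul,
    Submodule.coe_smul, inner_smul_left, inner_smul_right, real_inner_comm, ← inner_resolvent,
    ← inner_resolvent, real_inner_comm, conj_trivial]

theorem form_yosidaDom_le (u : Lp ℝ 2 μ) :
    E.form (E.yosidaDom β u) (E.yosidaDom β u) + β * ‖u - E.yosida β u‖ ^ 2 =
      β * inner ℝ (u - E.yosida β u) u := by
  rw [form_yosidaDom, yosidaDom_coe, ← real_inner_self_eq_norm_sq, ← mul_add, ← inner_add_right]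
  simp

/-- `β G_β u` minimizes `E(v, v) + β ‖v - u‖²`. -/
theorem yosida_minimizes (u : Lp ℝ 2 μ) (v : E.domain) :
    E.form v v + β * ‖(v : Lp ℝ 2 μ) - u‖ ^ 2 =
      E.form (E.yosidaDom β u) (E.yosidaDom β u) + β * ‖E.yosida β u - u‖ ^ 2 +
      (E.form (v - E.yosidaDom β u) (v - E.yosidaDom β u) +
        β * ‖(v : Lp ℝ 2 μ) - E.yosida β u‖ ^ 2) := by
  have h1 := E.form_yosidaDom β u (v - E.yosidaDom β u)
  set w := E.yosidaDom β u
  have h2 : (v : Lp ℝ 2 μ) - u = (v - w : E.domain) - (u - E.yosida β u) := by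
    rw [Submodule.coe_sub, yosidaDom_coe]; abel
  have h3 : E.form v v = E.form w w + 2 * E.form w (v - w) + E.form (v - w) (v - w) := by
    simp only [map_sub, LinearMap.sub_apply]
    rw [E.symm v w]; ring
  have h4 : E.yosida β u - u = -(u - E.yosida β u) := by abel
  rw [h3, h1, h2, norm_sub_sq_real, real_inner_comm, h4, norm_neg]
  rw [Submodule.coe_sub, yosidaDom_coe]
  ring

/-- Minimality is tested against u itself. This bounds the energy of βG_β u and forces ‖βG_β u - u‖²
≤ E(u, u)/β, the two inputs of weak compactness. -/
theorem form_sub_yosida (u : E.domain) :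
    E.form (E.yosidaDom β u) (E.yosidaDom β u) + β * ‖E.yosida β (u : Lp ℝ 2 μ) - u‖ ^ 2 ≤
      E.form u u := by
  have h := E.yosida_minimizes β (u : Lp ℝ 2 μ) u
  have h1 := E.nonneg (u - E.yosidaDom β u)
  have h2 : 0 ≤ β * ‖(u : Lp ℝ 2 μ) - E.yosida β u‖ ^ 2 := mul_nonneg hβ.out.le (by positivity)
  rw [sub_self, norm_zero] at h
  linarith

end Hilbert

/-! ### Approximation of the form by bounded forms on L² -/

section YosidaLimit

variable {K : Type*} [MeasurableSpace K] {μ : Measure K} (E : DirichletForm μ)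

instance (n : ℕ) : Fact ((0 : ℝ) < n + 1) := ⟨by positivity⟩

theorem tendsto_yosida_of_le (u : Lp ℝ 2 μ) (C : ℝ)
    (h : ∀ n : ℕ, ((n : ℝ) + 1) * ‖u - E.yosida (n + 1) u‖ ^ 2 ≤ C) :
    Tendsto (fun n : ℕ => E.yosida (n + 1) u) atTop (𝓝 u) := by
  rw [tendsto_iff_norm_sub_tendsto_zero]
  have h1 : Tendsto (fun n : ℕ => ‖E.yosida (n + 1) u - u‖ ^ 2) atTop (𝓝 0) := by
    have h2 := tendsto_one_div_add_atTop_nhds_zero_nat (𝕜 := ℝ).const_mul C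
    rw [mul_zero] at h2
    refine squeeze_zero (fun _ => by positivity) (fun n => ?_) h2
    rw [norm_sub_rev, mul_one_div, le_div_iff₀ (by positivity), mul_comm]
    exact h n
  simpa using h1.sqrt

/-- Convergence of the approximating forms on the domain. -/
theorem tendsto_approx (f g : E.domain) :
    Tendsto (fun n : ℕ => ((n : ℝ) + 1) *
      inner ℝ ((f : Lp ℝ 2 μ) - E.yosida (n + 1) (f : Lp ℝ 2 μ)) (g : Lp ℝ 2 μ))
      atTop (𝓝 (E.form f g)) := by
  have h := fun n : ℕ => E.form_sub_yosida (n + 1) f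
  have h0 := fun n : ℕ => E.nonneg (E.yosidaDom (n + 1) (f : Lp ℝ 2 μ))
  obtain ⟨w, hw, -, hlim⟩ := E.weak_limit (fun n => E.yosidaDom (n + 1) (f : Lp ℝ 2 μ)) f
    (E.form f f) (E.tendsto_yosida_of_le f (E.form f f) fun n => by
      rw [norm_sub_rev]; linarith [h n, h0 n]) (fun n => by
      have : 0 ≤ ((n : ℝ) + 1) * ‖E.yosida (n + 1) (f : Lp ℝ 2 μ) - f‖ ^ 2 := by positivity
      linarith [h n])
  rw [Subtype.ext hw] at hlim
  simpa only [form_yosidaDom] using hlim g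

/-- Elements of `L²` with bounded approximating forms belong to the domain. -/
theorem mem_domain_of_approx (u : Lp ℝ 2 μ) (C : ℝ)
    (h : ∀ n : ℕ, ((n : ℝ) + 1) * inner ℝ (u - E.yosida (n + 1) u) u ≤ C) :
    ∃ w : E.domain, (w : Lp ℝ 2 μ) = u ∧ E.form w w ≤ C := by
  have h1 := fun n : ℕ => E.form_yosidaDom_le (n + 1) u
  have h0 := fun n : ℕ => E.nonneg (E.yosidaDom (n + 1) u)
  obtain ⟨w, hw, hC, -⟩ := E.weak_limit (fun n => E.yosidaDom (n + 1) u) u C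
    (E.tendsto_yosida_of_le u C fun n => by linarith [h n, h0 n, h1 n]) (fun n => by
      have : 0 ≤ ((n : ℝ) + 1) * ‖u - E.yosida (n + 1) u‖ ^ 2 := by positivity
      linarith [h n, h1 n])
  exact ⟨w, hw, hC⟩

end YosidaLimit

/-! ### The Markov property of the resolvent -/

section Markov

variable {K : Type*} [MeasurableSpace K] {μ : Measure K} (E : DirichletForm μ)
  (β : ℝ) [hβ : Fact (0 < β)]

/-- The unit contraction of βG_β u has no more energy and, as 0 ≤ u ≤ 1, is no farther from u. It
therefore also minimizes, and the minimizer is unique. -/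
theorem yosida_unit (u : Lp ℝ 2 μ) (h0 : 0 ≤ᵐ[μ] u) (h1 : ∀ᵐ x ∂μ, u x ≤ 1) :
    ∀ᵐ x ∂μ, 0 ≤ E.yosida β u x ∧ E.yosida β u x ≤ 1 := by
  obtain ⟨v, hv, hvE⟩ := E.markov (E.yosidaDom β u)
  rw [yosidaDom_coe] at hv
  have hle : ‖(v : Lp ℝ 2 μ) - u‖ ≤ ‖E.yosida β u - u‖ := by
    refine Lp.norm_le_norm_of_ae_le ?_
    filter_upwards [hv, h0, h1, Lp.coeFn_sub (v : Lp ℝ 2 μ) u, Lp.coeFn_sub (E.yosida β u) u]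
      with x hx h0 h1 hs hs'
    rw [hs, hs']
    simp only [Pi.sub_apply, hx, Real.norm_eq_abs]
    simp only [Pi.zero_apply] at h0
    rcases le_total (E.yosida β u x) 0 with h | h
    · rw [max_eq_left h, min_eq_left zero_le_one, abs_le]
      rw [abs_of_nonpos (by linarith)]
      constructor <;> linarith
    · rw [max_eq_right h]
      rcases le_total (E.yosida β u x) 1 with h' | h'
      · rw [min_eq_left h']
      · rw [min_eq_right h', abs_of_nonneg (by linarith), abs_of_nonneg (by linarith)]
        linarith
  have hmin := E.yosida_minimizes β u v
  have hb := hβ.out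
  have h2 := E.nonneg (v - E.yosidaDom β u)
  have h3 : β * ‖(v : Lp ℝ 2 μ) - u‖ ^ 2 ≤ β * ‖E.yosida β u - u‖ ^ 2 := by gcongr
  have h4 : ‖(v : Lp ℝ 2 μ) - E.yosida β u‖ ^ 2 = 0 := by
    by_contra hne
    have : 0 < β * ‖(v : Lp ℝ 2 μ) - E.yosida β u‖ ^ 2 := by positivity
    linarith
  have h5 : (v : Lp ℝ 2 μ) = E.yosida β u := by
    rw [pow_eq_zero_iff two_ne_zero, norm_eq_zero, sub_eq_zero] at h4
    exact h4
  rw [h5] at hv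
  filter_upwards [hv] with x hx
  rw [hx]
  exact ⟨le_min (le_max_left _ _) zero_le_one, min_le_right _ _⟩

/-- Nonnegative simple functions are dense in the positive cone. They are bounded, so a scalar
multiple falls under `yosida_unit`. -/
theorem yosida_nonneg (u : Lp ℝ 2 μ) (h0 : 0 ≤ u) : 0 ≤ E.yosida β u := by
  have hcl : IsClosed {v : {g : Lp ℝ 2 μ // 0 ≤ g} | 0 ≤ E.yosida β v} :=
    isClosed_nonneg.preimage ((E.yosida β).continuous.comp continuous_subtype_val)
  have hd := Lp.simpleFunc.denseRange_coeSimpleFuncNonnegToLpNonneg 2 μ ℝ (by norm_num)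
  refine hd.induction_on (p := fun v : {g : Lp ℝ 2 μ // 0 ≤ g} => 0 ≤ E.yosida β v) ⟨u, h0⟩ hcl ?_
  rintro ⟨s, hs⟩
  change 0 ≤ E.yosida β (s : Lp ℝ 2 μ)
  obtain ⟨C, hC⟩ := (Lp.simpleFunc.toSimpleFunc s).exists_forall_norm_le
  have hs0 : 0 ≤ (s : Lp ℝ 2 μ) := hs
  have hs1 : ∀ᵐ x ∂μ, 0 ≤ (s : Lp ℝ 2 μ) x := (Lp.coeFn_nonneg _).mpr hs0
  have hs2 : ∀ᵐ x ∂μ, (s : Lp ℝ 2 μ) x ≤ |C| + 1 := by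
    filter_upwards [Lp.simpleFunc.toSimpleFunc_eq_toFun s] with x hx
    rw [← hx]
    linarith [(le_abs_self _).trans (hC x), le_abs_self C]
  have hC1 : 0 < |C| + 1 := by positivity
  have h := E.yosida_unit β ((|C| + 1)⁻¹ • (s : Lp ℝ 2 μ)) (by
    filter_upwards [hs1, Lp.coeFn_smul (|C| + 1)⁻¹ (s : Lp ℝ 2 μ)] with x h1 h2
    rw [h2]; exact mul_nonneg (by positivity) h1) (by
    filter_upwards [hs2, Lp.coeFn_smul (|C| + 1)⁻¹ (s : Lp ℝ 2 μ)] with x h1 h2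
    rw [h2, Pi.smul_apply, smul_eq_mul, inv_mul_le_iff₀ hC1, mul_one]; exact h1)
  rw [map_smul] at h
  rw [← Lp.coeFn_nonneg]
  filter_upwards [h, Lp.coeFn_smul (|C| + 1)⁻¹ (E.yosida β (s : Lp ℝ 2 μ))] with x h1 h2
  rw [h2, Pi.smul_apply, smul_eq_mul] at h1
  exact (mul_nonneg_iff_of_pos_left (by positivity)).mp h1.1

theorem yosida_le (u : Lp ℝ 2 μ) {c : ℝ} (hc : 0 ≤ c) (h0 : 0 ≤ u) (h : ∀ᵐ x ∂μ, u x ≤ c) :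
    ∀ᵐ x ∂μ, E.yosida β u x ≤ c := by
  rcases hc.eq_or_lt with rfl | hc
  · have : u = 0 := le_antisymm ((Lp.coeFn_le _ _).mp (by
      filter_upwards [h, Lp.coeFn_zero ℝ 2 μ] with x h1 h2
      rw [h2]; exact h1)) h0
    rw [this, map_zero]
    filter_upwards [Lp.coeFn_zero ℝ 2 μ] with x h2
    rw [h2]; rfl
  · have h := E.yosida_unit β (c⁻¹ • u) (by
      filter_upwards [(Lp.coeFn_nonneg _).mpr h0, Lp.coeFn_smul c⁻¹ u] with x h1 h2
      rw [h2]; exact mul_nonneg (by positivity) h1) (by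
      filter_upwards [h, Lp.coeFn_smul c⁻¹ u] with x h1 h2
      rw [h2, Pi.smul_apply, smul_eq_mul, inv_mul_le_iff₀ hc, mul_one]; exact h1)
    rw [map_smul] at h
    filter_upwards [h, Lp.coeFn_smul c⁻¹ (E.yosida β u)] with x h1 h2
    rw [h2, Pi.smul_apply, smul_eq_mul, inv_mul_le_iff₀ hc, mul_one] at h1
    exact h1.2

/-- The Markov property of `β G_β`. -/
theorem neg_le_yosida (u : Lp ℝ 2 μ) {c : ℝ} (hc : 0 ≤ c) (h : ∀ᵐ x ∂μ, -c ≤ u x) :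
    ∀ᵐ x ∂μ, -c ≤ E.yosida β u x := by
  have h1 := E.yosida_nonneg β (Lp.posPart u) ((Lp.coeFn_nonneg _).mp (by
    filter_upwards [Lp.coeFn_posPart u] with x hx
    rw [hx]; exact le_max_right _ _))
  have h2 := E.yosida_le β (Lp.negPart u) hc ((Lp.coeFn_nonneg _).mp (by
    filter_upwards [Lp.coeFn_negPart_eq_max u] with x hx
    rw [hx]; exact le_max_right _ _)) (by
    filter_upwards [Lp.coeFn_negPart_eq_max u, h] with x hx h1
    rw [hx]; exact max_le (by linarith) hc)
  have h3 : u = Lp.posPart u - Lp.negPart u := by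
    refine Lp.ext ?_
    filter_upwards [Lp.coeFn_negPart_eq_max u, Lp.coeFn_posPart u,
      Lp.coeFn_sub (Lp.posPart u) (Lp.negPart u)] with x h1 h2 h3
    rw [h3, Pi.sub_apply, h1, h2, max_zero_sub_max_neg_zero_eq_self]
  have h4 : E.yosida β u = E.yosida β (Lp.posPart u) - E.yosida β (Lp.negPart u) := by
    rw [← map_sub, ← h3]
  rw [h4]
  filter_upwards [h2, (Lp.coeFn_nonneg _).mpr h1,
    Lp.coeFn_sub (E.yosida β (Lp.posPart u)) (E.yosida β (Lp.negPart u))] with x a b d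
  rw [d, Pi.sub_apply]
  simp only [Pi.zero_apply] at b
  linarith

end Markov
end DirichletForm
end

noncomputable section
namespace DirichletForm

/-! ### The two-point inequality for the resolvent -/

section TwoPoint

variable {K : Type*} [MeasurableSpace K] {μ : Measure K} (E : DirichletForm μ)
  (β : ℝ) [hβ : Fact (0 < β)]

/-- For each fixed x the Markov property in y gives an exceptional null set that depends on x. The
inequality is closed in the coefficients (a(x), c(x)), which range over a separable set, so
countably many x suffice and the diagonal x = y becomes accessible. -/
theorem ae_forall_two_point {ι : Type*} [Fintype ι] (a : ι → K → ℝ) (B : ι → Lp ℝ 2 μ)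
    (c : K → ℝ) (W : Lp ℝ 2 μ) (hc : ∀ x, 0 ≤ c x)
    (hpos : ∀ x, ∀ᵐ y ∂μ, 0 ≤ ∑ i, a i x * B i y + c x + W y) :
    ∀ᵐ y ∂μ, 0 ≤ ∑ i, a i y * E.yosida β (B i) y + c y + E.yosida β W y := by
  have hsum : ∀ (t : ι → ℝ) (D : ι → Lp ℝ 2 μ) (V : Lp ℝ 2 μ),
      ((∑ i, t i • D i + V : Lp ℝ 2 μ) : K → ℝ) =ᵐ[μ] fun y => ∑ i, t i * D i y + V y := by
    intro t D V
    have h1 : ∀ s : Finset ι, ((∑ i ∈ s, t i • D i : Lp ℝ 2 μ) : K → ℝ) =ᵐ[μ]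
        fun y => ∑ i ∈ s, t i * D i y := by
      classical
      intro s
      induction s using Finset.induction_on with
      | empty =>
        simp only [Finset.sum_empty]
        exact Lp.coeFn_zero ℝ 2 μ
      | insert i s hi ih =>
        rw [Finset.sum_insert hi]
        filter_upwards [ih, Lp.coeFn_add (t i • D i) (∑ i ∈ s, t i • D i),
          Lp.coeFn_smul (t i) (D i)] with y h1 h2 h3
        rw [h2, Pi.add_apply, h1, h3, Finset.sum_insert hi, Pi.smul_apply, smul_eq_mul]
    filter_upwards [h1 Finset.univ, Lp.coeFn_add (∑ i, t i • D i) V] with y h1 h2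
    rw [h2, Pi.add_apply, h1]
  let v : K → (ι → ℝ) × ℝ := fun x => (fun i => a i x, c x)
  have hx : ∀ p : Set.range v, ∀ᵐ y ∂μ,
      0 ≤ ∑ i, p.1.1 i * E.yosida β (B i) y + p.1.2 + E.yosida β W y := by
    rintro ⟨_, x, rfl⟩
    have h1 := E.neg_le_yosida β (∑ i, a i x • B i + W) (hc x) (by
      filter_upwards [hpos x, hsum (fun i => a i x) B W] with y h1 h2
      rw [h2]; linarith)
    simp only [map_add, map_sum, map_smul] at h1
    filter_upwards [h1, hsum (fun i => a i x) (fun i => E.yosida β (B i)) (E.yosida β W)]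
      with y h1 h2
    rw [h2] at h1
    simp only [v]
    linarith
  obtain ⟨s, hs, hd⟩ := TopologicalSpace.exists_countable_dense (Set.range v)
  filter_upwards [(ae_ball_iff hs).2 fun p _ => hx p] with y hy
  have hcl : IsClosed {p : Set.range v |
      0 ≤ ∑ i, p.1.1 i * E.yosida β (B i) y + p.1.2 + E.yosida β W y} := by
    refine isClosed_le continuous_const ?_
    fun_prop
  have := hcl.closure_subset_iff.mpr hy (hd ⟨v y, y, rfl⟩)
  exact this

/-- The two-point inequality for the operator `β G_β`: a kernel that is a finite sum of products
and nonnegative off the diagonal stays so after integration. -/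
theorem two_point_approx [SigmaFinite μ] {ι : Type*} [Fintype ι] (a b : ι → K → ℝ) (c w : K → ℝ)
    (ha : ∀ i, MemLp (a i) 2 μ) (hb : ∀ i, MemLp (b i) 2 μ) (hw2 : MemLp w 2 μ)
    (hw1 : Integrable w μ) (hc : ∀ x, 0 ≤ c x) (hw : ∀ x, 0 ≤ w x)
    (hpos : ∀ x y, 0 ≤ ∑ i, a i x * b i y + c x + w y)
    (hdiag : ∀ x, ∑ i, a i x * b i x + c x + w x = 0) :
    ∑ i, inner ℝ ((hb i).toLp - E.yosida β (hb i).toLp) (ha i).toLp ≤ 0 := by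
  have hg := E.ae_forall_two_point β a (fun i => (hb i).toLp) c hw2.toLp hc (fun x => by
    have h1 : ∀ᵐ y ∂μ, ∀ i, ((hb i).toLp (b i) : K → ℝ) y = b i y := ae_all_iff.mpr fun i => (hb i).coeFn_toLp
    filter_upwards [h1, hw2.coeFn_toLp] with y h1 h2
    simp only [h1, h2]
    exact hpos x y)
  set R := fun i => E.yosida β (hb i).toLp with hR
  set V := E.yosida β hw2.toLp with hV
  have hab : ∀ i, Integrable (fun x => a i x * b i x) μ := fun i => (ha i).integrable_mul (hb i)
  have haR : ∀ i, Integrable (fun x => a i x * R i x) μ := fun i =>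
    (ha i).integrable_mul (Lp.memLp _)
  have hcI : Integrable c μ := by
    have h1 : c = fun x => -(∑ i, a i x * b i x) - w x := by
      funext x; linarith [hdiag x]
    rw [h1]
    exact (integrable_finsetSum _ fun i _ => hab i).neg.sub hw1
  have hF : Integrable (fun x => ∑ i, a i x * R i x + c x) μ :=
    (integrable_finsetSum _ fun i _ => haR i).add hcI
  -- By symmetry βG_β moves from w to the indicator of a set of finite measure, where it yields a
  -- function that is at most 1. The terms c(x) and w(y) stand for products with the constant 1,
  -- which need not lie in L².
  have hVle : ∀ n, ∫ x in spanningSets μ n, V x ∂μ ≤ ∫ x, w x ∂μ := by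
    intro n
    have hm := measurableSet_spanningSets μ n
    have hfin := (measure_spanningSets_lt_top μ n).ne
    set χ : Lp ℝ 2 μ := indicatorConstLp 2 hm hfin (1 : ℝ) with hχ
    have hχ0 : 0 ≤ χ := (Lp.coeFn_nonneg _).mp (by
      filter_upwards [indicatorConstLp_coeFn (p := 2) (hs := hm) (hμs := hfin) (c := (1 : ℝ))]
        with x hx
      rw [hx]; exact Set.indicator_nonneg (fun _ _ => zero_le_one) x)
    have hχ1 := E.yosida_le β χ zero_le_one hχ0 (by
      filter_upwards [indicatorConstLp_coeFn (p := 2) (hs := hm) (hμs := hfin) (c := (1 : ℝ))]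
        with x hx
      rw [hx]; exact Set.indicator_apply_le' (fun _ => le_rfl) fun _ => zero_le_one)
    rw [← L2.inner_indicatorConstLp_one (𝕜 := ℝ) hm hfin V, hV, ← yosida_symm, L2.inner_def]
    refine integral_mono_ae (L2.integrable_inner _ _) hw1 ?_
    filter_upwards [hχ1, hw2.coeFn_toLp] with x h1 h2
    rw [h2]
    simp only [RCLike.inner_apply, conj_trivial]
    have := hw x
    nlinarith
  have hn : ∀ n, -∫ x, w x ∂μ ≤ ∫ x in spanningSets μ n, (∑ i, a i x * R i x + c x) ∂μ := by
    intro n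
    have : IsFiniteMeasure (μ.restrict (spanningSets μ n)) :=
      ⟨by simpa using measure_spanningSets_lt_top μ n⟩
    have hVi : IntegrableOn V (spanningSets μ n) μ :=
      ((Lp.memLp V).restrict _).integrable one_le_two
    have h1 : 0 ≤ ∫ x in spanningSets μ n, ((∑ i, a i x * R i x + c x) + V x) ∂μ :=
      integral_nonneg_of_ae (ae_restrict_of_ae hg)
    rw [integral_add hF.integrableOn hVi] at h1
    linarith [hVle n]
  -- Only the part without V is known to be integrable over all of K; V has already been replaced by
  -- its bound ∫ w on each finite piece.
  have hlim := tendsto_setIntegral_of_monotone (measurableSet_spanningSets μ)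
    (monotone_spanningSets μ) (f := fun x => ∑ i, a i x * R i x + c x) (μ := μ) hF.integrableOn
  rw [iUnion_spanningSets, Measure.restrict_univ] at hlim
  have h0 := ge_of_tendsto' hlim hn
  have e1 : ∀ i, inner ℝ ((hb i).toLp - R i) (ha i).toLp =
      ∫ x, a i x * b i x ∂μ - ∫ x, a i x * R i x ∂μ := by
    intro i
    rw [← integral_sub (hab i) (haR i), L2.inner_def]
    refine integral_congr_ae ?_
    filter_upwards [Lp.coeFn_sub (hb i).toLp (R i), (hb i).coeFn_toLp, (ha i).coeFn_toLp]
      with x h1 h2 h3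
    rw [h1, Pi.sub_apply, h2, h3]
    simp only [RCLike.inner_apply, conj_trivial]
    ring
  have e2 : ∫ x, (∑ i, a i x * R i x + c x) ∂μ = ∑ i, ∫ x, a i x * R i x ∂μ + ∫ x, c x ∂μ := by
    rw [integral_add (integrable_finsetSum _ fun i _ => haR i) hcI,
      integral_finsetSum _ fun i _ => haR i]
  have e3 : ∑ i, ∫ x, a i x * b i x ∂μ + ∫ x, c x ∂μ + ∫ x, w x ∂μ = 0 := by
    rw [← integral_finsetSum _ fun i _ => hab i,
      ← integral_add (integrable_finsetSum _ fun i _ => hab i) hcI, ← integral_add ?_ hw1]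
    · simp [hdiag]
    · exact (integrable_finsetSum _ fun i _ => hab i).add hcI
  change ∑ i, inner ℝ ((hb i).toLp - R i) (ha i).toLp ≤ 0
  simp only [e1, Finset.sum_sub_distrib]
  linarith

end TwoPoint

/-! ### The form on functions; contractions and products -/

section Functions

variable {K : Type*} [MeasurableSpace K] {μ : Measure K} (E : DirichletForm μ)

/-- `u` represents an element of the domain. -/
def Dom (u : K → ℝ) : Prop := ∃ g : E.domain, ((g : Lp ℝ 2 μ) : K → ℝ) =ᵐ[μ] u

open Classical in
/-- The element of the domain represented by `u`. -/
def cls (u : K → ℝ) : E.domain := if h : E.Dom u then h.choose else 0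

/-- The form on functions. -/
def en (u v : K → ℝ) : ℝ := E.form (E.cls u) (E.cls v)

variable {E}

theorem Dom.coe_cls {u : K → ℝ} (h : E.Dom u) : ((E.cls u : Lp ℝ 2 μ) : K → ℝ) =ᵐ[μ] u := by
  rw [cls, dif_pos h]; exact h.choose_spec

theorem cls_eq {u : K → ℝ} {g : E.domain} (h : ((g : Lp ℝ 2 μ) : K → ℝ) =ᵐ[μ] u) :
    E.cls u = g :=
  Subtype.ext (Lp.ext ((Dom.coe_cls ⟨g, h⟩).trans h.symm))

theorem Dom.congr {u v : K → ℝ} (h : E.Dom u) (huv : u =ᵐ[μ] v) : E.Dom v :=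
  ⟨E.cls u, h.coe_cls.trans huv⟩

theorem Dom.memLp {u : K → ℝ} (h : E.Dom u) : MemLp u 2 μ :=
  (Lp.memLp (E.cls u : Lp ℝ 2 μ)).ae_eq h.coe_cls

theorem Dom.toLp_eq {u : K → ℝ} (h : E.Dom u) (h' : MemLp u 2 μ) :
    h'.toLp = (E.cls u : Lp ℝ 2 μ) :=
  Lp.ext (h'.coeFn_toLp.trans h.coe_cls.symm)

theorem coe_add_ae {u v : K → ℝ} {f g : E.domain} (hu : ((f : Lp ℝ 2 μ) : K → ℝ) =ᵐ[μ] u)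
    (hv : ((g : Lp ℝ 2 μ) : K → ℝ) =ᵐ[μ] v) :
    (((f + g : E.domain) : Lp ℝ 2 μ) : K → ℝ) =ᵐ[μ] fun x => u x + v x := by
  rw [Submodule.coe_add]
  filter_upwards [hu, hv, Lp.coeFn_add (f : Lp ℝ 2 μ) (g : Lp ℝ 2 μ)] with x h1 h2 h3
  rw [h3, Pi.add_apply, h1, h2]

theorem coe_smul_ae {u : K → ℝ} {f : E.domain} (r : ℝ)
    (hu : ((f : Lp ℝ 2 μ) : K → ℝ) =ᵐ[μ] u) :
    (((r • f : E.domain) : Lp ℝ 2 μ) : K → ℝ) =ᵐ[μ] fun x => r * u x := by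
  rw [Submodule.coe_smul]
  filter_upwards [hu, Lp.coeFn_smul r (f : Lp ℝ 2 μ)] with x h1 h3
  rw [h3, Pi.smul_apply, smul_eq_mul, h1]

theorem Dom.add {u v : K → ℝ} (hu : E.Dom u) (hv : E.Dom v) : E.Dom fun x => u x + v x :=
  ⟨_, coe_add_ae hu.coe_cls hv.coe_cls⟩

theorem Dom.const_mul {u : K → ℝ} (hu : E.Dom u) (r : ℝ) : E.Dom fun x => r * u x :=
  ⟨_, coe_smul_ae r hu.coe_cls⟩

theorem Dom.sub {u v : K → ℝ} (hu : E.Dom u) (hv : E.Dom v) : E.Dom fun x => u x - v x := by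
  have := hu.add (hv.const_mul (-1))
  simpa [← sub_eq_add_neg] using this

theorem cls_add {u v : K → ℝ} (hu : E.Dom u) (hv : E.Dom v) :
    E.cls (fun x => u x + v x) = E.cls u + E.cls v :=
  cls_eq (coe_add_ae hu.coe_cls hv.coe_cls)

theorem cls_const_mul {u : K → ℝ} (hu : E.Dom u) (r : ℝ) :
    E.cls (fun x => r * u x) = r • E.cls u :=
  cls_eq (coe_smul_ae r hu.coe_cls)

theorem cls_sub {u v : K → ℝ} (hu : E.Dom u) (hv : E.Dom v) :
    E.cls (fun x => u x - v x) = E.cls u - E.cls v := by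
  have := cls_add hu (hv.const_mul (-1))
  rw [cls_const_mul hv, neg_one_smul, ← sub_eq_add_neg] at this
  rw [← this]
  congr 1; funext x; ring

theorem dom_zero : E.Dom fun _ => 0 := ⟨0, Lp.coeFn_zero ℝ 2 μ⟩

theorem en_comm (u v : K → ℝ) : E.en u v = E.en v u := E.symm _ _

theorem en_self_nonneg (u : K → ℝ) : 0 ≤ E.en u u := E.nonneg _

theorem en_add_left {u v : K → ℝ} (hu : E.Dom u) (hv : E.Dom v) (w : K → ℝ) :
    E.en (fun x => u x + v x) w = E.en u w + E.en v w := by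
  simp only [en, cls_add hu hv, map_add, LinearMap.add_apply]

theorem en_sub_left {u v : K → ℝ} (hu : E.Dom u) (hv : E.Dom v) (w : K → ℝ) :
    E.en (fun x => u x - v x) w = E.en u w - E.en v w := by
  simp only [en, cls_sub hu hv, map_sub, LinearMap.sub_apply]

theorem en_const_mul_left {u : K → ℝ} (hu : E.Dom u) (r : ℝ) (w : K → ℝ) :
    E.en (fun x => r * u x) w = r * E.en u w := by
  simp only [en, cls_const_mul hu, map_smul, LinearMap.smul_apply, smul_eq_mul]

theorem en_add_right {u v : K → ℝ} (hu : E.Dom u) (hv : E.Dom v) (w : K → ℝ) :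
    E.en w (fun x => u x + v x) = E.en w u + E.en w v := by
  simp only [en, cls_add hu hv, map_add]

theorem en_sub_right {u v : K → ℝ} (hu : E.Dom u) (hv : E.Dom v) (w : K → ℝ) :
    E.en w (fun x => u x - v x) = E.en w u - E.en w v := by
  simp only [en, cls_sub hu hv, map_sub]

theorem en_const_mul_right {u : K → ℝ} (hu : E.Dom u) (r : ℝ) (w : K → ℝ) :
    E.en w (fun x => r * u x) = r * E.en w u := by
  simp only [en, cls_const_mul hu, map_smul, smul_eq_mul]

theorem tendsto_approx_en {u v : K → ℝ} (hu : E.Dom u) (hv : E.Dom v) (hu' : MemLp u 2 μ)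
    (hv' : MemLp v 2 μ) :
    Tendsto (fun n : ℕ => ((n : ℝ) + 1) * inner ℝ (hu'.toLp - E.yosida (n + 1) hu'.toLp) hv'.toLp)
      atTop (𝓝 (E.en u v)) := by
  rw [hu.toLp_eq hu', hv.toLp_eq hv']
  exact E.tendsto_approx _ _

/-- The two-point inequality for a Dirichlet form. -/
theorem two_point [SigmaFinite μ] {ι : Type*} [Fintype ι] (a b : ι → K → ℝ) (c w : K → ℝ)
    (ha : ∀ i, E.Dom (a i)) (hb : ∀ i, E.Dom (b i)) (hw2 : MemLp w 2 μ)
    (hw1 : Integrable w μ) (hc : ∀ x, 0 ≤ c x) (hw : ∀ x, 0 ≤ w x)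
    (hpos : ∀ x y, 0 ≤ ∑ i, a i x * b i y + c x + w y)
    (hdiag : ∀ x, ∑ i, a i x * b i x + c x + w x = 0) :
    ∑ i, E.en (a i) (b i) ≤ 0 := by
  have hlim := tendsto_finsetSum Finset.univ fun i (_ : i ∈ Finset.univ) =>
    tendsto_approx_en (hb i) (ha i) (hb i).memLp (ha i).memLp
  simp only [en_comm (a _)]
  refine le_of_tendsto' hlim fun n => ?_
  rw [← Finset.mul_sum]
  exact mul_nonpos_of_nonneg_of_nonpos (by positivity)
    (E.two_point_approx (n + 1) a b c w (fun i => (ha i).memLp) (fun i => (hb i).memLp)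
      hw2 hw1 hc hw hpos hdiag)

/-- The two-point inequality for kernels that vanish on the diagonal. -/
theorem two_point_diag [SigmaFinite μ] {ι : Type*} [Fintype ι] (a b : ι → K → ℝ)
    (ha : ∀ i, E.Dom (a i)) (hb : ∀ i, E.Dom (b i))
    (hpos : ∀ x y, 0 ≤ ∑ i, a i x * b i y) (hdiag : ∀ x, ∑ i, a i x * b i x = 0) :
    ∑ i, E.en (a i) (b i) ≤ 0 :=
  two_point a b 0 0 ha hb MemLp.zero (integrable_zero _ _ _) (fun _ => le_rfl) (fun _ => le_rfl)
    (by simpa using hpos) (by simpa using hdiag)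

theorem memLp_of_sq_le {u v : K → ℝ} (hu : MemLp u 2 μ) {M : ℝ} (hv : AEStronglyMeasurable v μ)
    (h : ∀ x, |v x| ≤ M * |u x|) : MemLp v 2 μ :=
  hu.of_le_mul hv (Eventually.of_forall h)

/-- Normal contractions operate on bounded elements of the domain. -/
theorem Dom.contraction [SigmaFinite μ] {u v : K → ℝ} (hu : E.Dom u) {M : ℝ}
    (hM : ∀ x, |u x| ≤ M) (hv : AEStronglyMeasurable v μ) {L : ℝ}
    (h0 : ∀ x, |v x| ≤ L * |u x|) (h1 : ∀ x y, |v x - v y| ≤ L * |u x - u y|) :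
    E.Dom v ∧ E.en v v ≤ L ^ 2 * E.en u u := by
  have hv2 : MemLp v 2 μ := memLp_of_sq_le hu.memLp hv h0
  -- With this w the kernel v(x)v(y) - L² u(x)u(y) + w(x) + w(y) equals half of L²(u(x) - u(y))² -
  -- (v(x) - v(y))². It is nonnegative and vanishes on the diagonal.
  set w : K → ℝ := fun x => (L ^ 2 * (u x * u x) - v x * v x) / 2 with hw
  have hw0 : ∀ x, 0 ≤ w x := fun x => by
    have := mul_self_le_mul_self (abs_nonneg _) (h0 x)
    rw [abs_mul_abs_self, mul_mul_mul_comm, abs_mul_abs_self] at this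
    simp only [hw]; nlinarith
  have hw1 : Integrable w μ := by
    refine Integrable.div_const (Integrable.sub (Integrable.const_mul ?_ _) ?_) _
    · exact hu.memLp.integrable_mul hu.memLp
    · exact hv2.integrable_mul hv2
  have hw2 : MemLp w 2 μ := by
    refine memLp_of_sq_le hu.memLp (M := L ^ 2 * M) hw1.aestronglyMeasurable fun x => ?_
    rw [abs_of_nonneg (hw0 x)]
    have h2 : u x * u x ≤ M * |u x| := by
      rw [← abs_mul_abs_self]
      exact mul_le_mul_of_nonneg_right (hM x) (abs_nonneg _)
    have h3 : L ^ 2 * (u x * u x) ≤ L ^ 2 * (M * |u x|) := by gcongr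
    simp only [hw]
    nlinarith [mul_self_nonneg (v x), mul_nonneg (sq_nonneg L) (mul_self_nonneg (u x))]
  have key : ∀ n : ℕ, ((n : ℝ) + 1) * inner ℝ (hv2.toLp - E.yosida (n + 1) hv2.toLp) hv2.toLp ≤
      L ^ 2 * E.en u u := by
    intro n
    have h := E.two_point_approx (n + 1) ![v, (-L ^ 2) • u] ![v, u] w w
      (by
        intro i; fin_cases i
        · exact hv2
        · exact hu.memLp.const_smul _)
      (by
        intro i; fin_cases i
        · exact hv2
        · exact hu.memLp)
      hw2 hw1 hw0 hw0
      (by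
        intro x y
        have := mul_self_le_mul_self (abs_nonneg _) (h1 x y)
        rw [abs_mul_abs_self, mul_mul_mul_comm, abs_mul_abs_self] at this
        simp [Fin.sum_univ_two, hw]
        nlinarith)
      (by
        intro x
        simp [Fin.sum_univ_two, hw]
        ring)
    rw [Fin.sum_univ_two] at h
    change inner ℝ (hv2.toLp - E.yosida (n + 1) hv2.toLp) hv2.toLp +
      inner ℝ (hu.memLp.toLp - E.yosida (n + 1) hu.memLp.toLp)
        ((hu.memLp.const_smul (-L ^ 2)).toLp) ≤ 0 at h
    rw [MemLp.toLp_const_smul _ hu.memLp, inner_smul_right, hu.toLp_eq] at h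
    have h3 := E.form_yosidaDom_le (n + 1) (E.cls u)
    have h4 := E.form_yosidaDom (n + 1) (E.cls u) (E.cls u)
    have h5 := E.form_sub_yosida (n + 1) (E.cls u)
    have h6 : ((n : ℝ) + 1) * inner ℝ ((E.cls u : Lp ℝ 2 μ) - E.yosida (n + 1) (E.cls u))
        (E.cls u : Lp ℝ 2 μ) ≤ E.en u u := by
      rw [← h3, norm_sub_rev]; exact h5
    have hn : (0 : ℝ) < n + 1 := by positivity
    nlinarith [mul_le_mul_of_nonneg_left h6 (sq_nonneg L)]
  obtain ⟨g, hg, hgE⟩ := E.mem_domain_of_approx hv2.toLp _ key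
  have hgv : ((g : Lp ℝ 2 μ) : K → ℝ) =ᵐ[μ] v := by rw [hg]; exact hv2.coeFn_toLp
  refine ⟨⟨g, hgv⟩, ?_⟩
  rw [en, cls_eq hgv]
  exact hgE

theorem Dom.sq [SigmaFinite μ] {u : K → ℝ} (hu : E.Dom u) {M : ℝ} (hM : ∀ x, |u x| ≤ M) :
    E.Dom fun x => u x ^ 2 := by
  refine (hu.contraction hM (hu.memLp.1.pow 2) (L := 2 * M) (fun x => ?_)
    fun x y => ?_).1
  · rw [Pi.pow_apply, abs_pow, pow_two]
    exact mul_le_mul_of_nonneg_right (by linarith [hM x, abs_nonneg (u x)]) (abs_nonneg _)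
  · rw [Pi.pow_apply, Pi.pow_apply, sq_sub_sq, abs_mul]
    exact mul_le_mul_of_nonneg_right ((abs_add_le _ _).trans (by linarith [hM x, hM y]))
      (abs_nonneg _)

theorem Dom.mul [SigmaFinite μ] {u v : K → ℝ} (hu : E.Dom u) {M : ℝ} (hM : ∀ x, |u x| ≤ M)
    (hv : E.Dom v) {N : ℝ} (hN : ∀ x, |v x| ≤ N) : E.Dom fun x => u x * v x := by
  have h1 := (hu.add hv).sq (M := M + N) fun x => (abs_add_le _ _).trans (add_le_add (hM x) (hN x))
  have h2 := (hu.sub hv).sq (M := M + N) fun x => (abs_sub _ _).trans (add_le_add (hM x) (hN x))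
  refine ((h1.sub h2).const_mul (1 / 4)).congr (Eventually.of_forall fun x => ?_)
  ring

end Functions
end DirichletForm
end

noncomputable section
namespace DirichletForm

/-! ### The energy functional of a bounded function -/

section Functional

variable {K : Type*} [MeasurableSpace K] {μ : Measure K} [SigmaFinite μ] {E : DirichletForm μ}

variable (E) in
/-- The functional `φ ↦ 2 E(f φ, f) - E(φ, f²)`. -/
def energyFunctional (f φ : K → ℝ) : ℝ :=
  2 * E.en (fun x => f x * φ x) f - E.en φ (fun x => f x ^ 2)

/-- The two-point inequality is applied to φ(x)(f(x) - f(y))². The summand φ(x)f(x)² is carried by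
`c`. -/
theorem energyFunctional_nonneg {f φ : K → ℝ} (hf : E.Dom f) {M : ℝ} (hM : ∀ x, |f x| ≤ M)
    (hφ : E.Dom φ) {N : ℝ} (hN : ∀ x, |φ x| ≤ N) (h0 : ∀ x, 0 ≤ φ x) :
    0 ≤ E.energyFunctional f φ := by
  have hfφ := hf.mul hM hφ hN
  have h := two_point (E := E) ![φ, fun x => (-2) * (f x * φ x)] ![fun x => f x ^ 2, f]
    (fun x => φ x * f x ^ 2) 0
    (by
      intro i; fin_cases i
      · exact hφ
      · exact hfφ.const_mul _)
    (by
      intro i; fin_cases i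
      · exact hf.sq hM
      · exact hf)
    MemLp.zero (integrable_zero _ _ _) (fun x => mul_nonneg (h0 x) (sq_nonneg _)) (fun _ => le_rfl)
    (fun x y => by
      have := mul_nonneg (h0 x) (sq_nonneg (f x - f y))
      simp [Fin.sum_univ_two]
      nlinarith)
    (fun x => by simp [Fin.sum_univ_two]; ring)
  rw [Fin.sum_univ_two] at h
  change E.en φ (fun x => f x ^ 2) + E.en (fun x => (-2) * (f x * φ x)) f ≤ 0 at h
  rw [en_const_mul_left hfφ] at h
  rw [energyFunctional]
  linarith

/-- The kernel is (N - φ(x))(f(x) - f(y))². The summand N f(y)² is a function of y alone and goes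
into `w`. -/
theorem energyFunctional_le {f φ : K → ℝ} (hf : E.Dom f) {M : ℝ} (hM : ∀ x, |f x| ≤ M)
    (hφ : E.Dom φ) {N : ℝ} (hN : ∀ x, |φ x| ≤ N) (hN0 : 0 ≤ N) :
    E.energyFunctional f φ ≤ 2 * N * E.en f f := by
  have hfφ := hf.mul hM hφ hN
  have h := two_point (E := E) ![fun x => 2 * (f x * φ x), fun x => (-1) * φ x,
      fun x => (-2 * N) * f x] ![f, fun x => f x ^ 2, f]
    (fun x => (N - φ x) * f x ^ 2) (fun x => N * f x ^ 2)
    (by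
      intro i; fin_cases i
      · exact hfφ.const_mul _
      · exact hφ.const_mul _
      · exact hf.const_mul _)
    (by
      intro i; fin_cases i
      · exact hf
      · exact hf.sq hM
      · exact hf)
    ((hf.sq hM).const_mul _).memLp (hf.memLp.integrable_sq.const_mul _)
    (fun x => mul_nonneg (sub_nonneg.mpr ((le_abs_self _).trans (hN x))) (sq_nonneg _))
    (fun x => by positivity)
    (fun x y => by
      have := mul_nonneg (sub_nonneg.mpr ((le_abs_self _).trans (hN x))) (sq_nonneg (f x - f y))
      simp [Fin.sum_univ_three]
      nlinarith)
    (fun x => by simp [Fin.sum_univ_three]; ring)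
  rw [Fin.sum_univ_three] at h
  change E.en (fun x => 2 * (f x * φ x)) f + E.en (fun x => (-1) * φ x) (fun x => f x ^ 2) +
    E.en (fun x => (-2 * N) * f x) f ≤ 0 at h
  rw [en_const_mul_left hfφ, en_const_mul_left hφ, en_const_mul_left hf] at h
  rw [energyFunctional]
  linarith

theorem energyFunctional_add {f φ ψ : K → ℝ} (hf : E.Dom f) {M : ℝ} (hM : ∀ x, |f x| ≤ M)
    (hφ : E.Dom φ) {N : ℝ} (hN : ∀ x, |φ x| ≤ N) (hψ : E.Dom ψ) {N' : ℝ} (hN' : ∀ x, |ψ x| ≤ N') :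
    E.energyFunctional f (fun x => φ x + ψ x) =
      E.energyFunctional f φ + E.energyFunctional f ψ := by
  simp only [energyFunctional]
  rw [en_add_left hφ hψ]
  have : (fun x => f x * (φ x + ψ x)) = fun x => f x * φ x + f x * ψ x := by funext x; ring
  rw [this, en_add_left (hf.mul hM hφ hN) (hf.mul hM hψ hN')]
  ring

theorem energyFunctional_const_mul {f φ : K → ℝ} (hf : E.Dom f) {M : ℝ} (hM : ∀ x, |f x| ≤ M)
    (hφ : E.Dom φ) {N : ℝ} (hN : ∀ x, |φ x| ≤ N) (r : ℝ) :
    E.energyFunctional f (fun x => r * φ x) = r * E.energyFunctional f φ := by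
  simp only [energyFunctional]
  rw [en_const_mul_left hφ]
  have : (fun x => f x * (r * φ x)) = fun x => r * (f x * φ x) := by funext x; ring
  rw [this, en_const_mul_left (hf.mul hM hφ hN)]
  ring

/-- A weighted parallelogram identity. -/
theorem energyFunctional_parallelogram {f g φ : K → ℝ} (hf : E.Dom f) {M : ℝ}
    (hM : ∀ x, |f x| ≤ M) (hg : E.Dom g) {M' : ℝ} (hM' : ∀ x, |g x| ≤ M')
    (hφ : E.Dom φ) {N : ℝ} (hN : ∀ x, |φ x| ≤ N) {s : ℝ} (hs : s ≠ 0) :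
    E.energyFunctional (fun x => f x + g x) φ +
        E.energyFunctional (fun x => s * f x - s⁻¹ * g x) φ =
      (1 + s ^ 2) * E.energyFunctional f φ + (1 + (s⁻¹) ^ 2) * E.energyFunctional g φ := by
  have hfφ := hf.mul hM hφ hN
  have hgφ := hg.mul hM' hφ hN
  have hff := hf.sq hM
  have hgg := hg.sq hM'
  have hfg := hf.mul hM hg hM'
  simp only [energyFunctional]
  have e1 : (fun x => (f x + g x) * φ x) = fun x => f x * φ x + g x * φ x := by funext x; ring
  have e2 : (fun x => (s * f x - s⁻¹ * g x) * φ x) =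
    fun x => s * (f x * φ x) - s⁻¹ * (g x * φ x) := by funext x; ring
  have e3 : (fun x => (f x + g x) ^ 2) = fun x => (f x ^ 2 + g x ^ 2) + 2 * (f x * g x) := by
    funext x; ring
  have e4 : (fun x => (s * f x - s⁻¹ * g x) ^ 2) =
      fun x => (s ^ 2 * f x ^ 2 + (s⁻¹) ^ 2 * g x ^ 2) - 2 * (f x * g x) := by
    funext x
    have : s * s⁻¹ = 1 := mul_inv_cancel₀ hs
    linear_combination (-2 * f x * g x) * this
  rw [e1, e2, e3, e4, en_add_left hfφ hgφ, en_sub_left (hfφ.const_mul _) (hgφ.const_mul _),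
    en_const_mul_left hfφ, en_const_mul_left hgφ, en_add_right hf hg, en_add_right hf hg,
    en_sub_right (hf.const_mul _) (hg.const_mul _), en_sub_right (hf.const_mul _) (hg.const_mul _),
    en_const_mul_right hf, en_const_mul_right hf, en_const_mul_right hg, en_const_mul_right hg,
    en_add_right (hff.add hgg) (hfg.const_mul _), en_add_right hff hgg,
    en_sub_right ((hff.const_mul _).add (hgg.const_mul _)) (hfg.const_mul _),
    en_add_right (hff.const_mul _) (hgg.const_mul _), en_const_mul_right hff,
    en_const_mul_right hgg, en_const_mul_right hfg]
  have : s * s⁻¹ = 1 := mul_inv_cancel₀ hs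
  linear_combination (-2 * E.en (fun x => f x * φ x) g - 2 * E.en (fun x => g x * φ x) f) * this

end Functional

/-! ### The algebra F ∩ C₀(K) -/

section Core

variable {K : Type*} [TopologicalSpace K] [MeasurableSpace K] {μ : Measure K}
  {E : DirichletForm μ}

variable (E) in
/-- `F ∩ C₀(K)`, as a set of functions. -/
structure Core (φ : K → ℝ) : Prop where
  continuous : Continuous φ
  compact : HasCompactSupport φ
  dom : E.Dom φ

/-- A continuous function with compact support as an element of `C_c(K, ℝ)`. -/
def toCc (φ : K → ℝ) (h1 : Continuous φ) (h2 : HasCompactSupport φ) : C_c(K, ℝ) := ⟨⟨φ, h1⟩, h2⟩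

theorem Core.bounded {φ : K → ℝ} (h : E.Core φ) : ∃ M, ∀ x, |φ x| ≤ M :=
  h.continuous.bounded_above_of_compact_support h.compact

theorem Core.add {φ ψ : K → ℝ} (h : E.Core φ) (h' : E.Core ψ) : E.Core fun x => φ x + ψ x :=
  ⟨h.continuous.add h'.continuous, h.compact.add h'.compact, h.dom.add h'.dom⟩

theorem Core.const_mul {φ : K → ℝ} (h : E.Core φ) (r : ℝ) : E.Core fun x => r * φ x :=
  ⟨continuous_const.mul h.continuous, h.compact.mul_left, h.dom.const_mul r⟩

theorem Core.sub {φ ψ : K → ℝ} (h : E.Core φ) (h' : E.Core ψ) : E.Core fun x => φ x - ψ x := by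
  have := h.add (h'.const_mul (-1))
  simpa [← sub_eq_add_neg] using this

theorem Core.mul [SigmaFinite μ] {φ ψ : K → ℝ} (h : E.Core φ) (h' : E.Core ψ) :
    E.Core fun x => φ x * ψ x := by
  obtain ⟨M, hM⟩ := h.bounded
  obtain ⟨N, hN⟩ := h'.bounded
  exact ⟨h.continuous.mul h'.continuous, h.compact.mul_right, h.dom.mul hM h'.dom hN⟩

theorem Core.comp [SigmaFinite μ] {φ : K → ℝ} (h : E.Core φ) {T : ℝ → ℝ} {L : ℝ}
    (hT : Continuous T) (h0 : T 0 = 0) (hL : ∀ s t, |T s - T t| ≤ L * |s - t|) :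
    E.Core fun x => T (φ x) := by
  obtain ⟨M, hM⟩ := h.bounded
  refine ⟨hT.comp h.continuous, h.compact.comp_left h0, (h.dom.contraction hM
    (hT.comp_aestronglyMeasurable h.dom.memLp.1) (fun x => ?_) fun x y => hL _ _).1⟩
  simpa [h0] using hL (φ x) 0

theorem Core.pos [SigmaFinite μ] {φ : K → ℝ} (h : E.Core φ) : E.Core fun x => max (φ x) 0 :=
  h.comp (T := fun t => max t 0) (L := 1) (by fun_prop) (by simp)
    fun s t => by rw [one_mul]; exact abs_max_sub_max_le_abs s t 0

theorem IsRegular.exists_core_approx [SigmaFinite μ] (hE : E.IsRegular) {φ : K → ℝ}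
    (h1 : Continuous φ) (h2 : HasCompactSupport φ) (h0 : ∀ x, 0 ≤ φ x) {ε : ℝ} (hε : 0 < ε) :
    ∃ ψ, E.Core ψ ∧ (∀ x, 0 ≤ ψ x) ∧ ∀ x, |φ x - ψ x| < ε := by
  obtain ⟨g, ψ, hg, hψ⟩ := hE.dense_uniform (toCc φ h1 h2) ε hε
  have hc : E.Core ψ := ⟨ψ.continuous, ψ.hasCompactSupport, g, hg⟩
  refine ⟨_, hc.pos, fun x => le_max_right _ _, fun x => lt_of_le_of_lt ?_ (hψ x)⟩
  change |φ x - max (ψ x) 0| ≤ |φ x - ψ x|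
  have := abs_max_sub_max_le_abs (φ x) (ψ x) 0
  rwa [max_eq_left (h0 x)] at this

end Core

/-! ### Comparison of finite measures by test functions -/

section Compare

variable {K : Type*} [TopologicalSpace K] [LocallyCompactSpace K]
    [TopologicalSpace.SeparableSpace K] [TopologicalSpace.MetrizableSpace K]
    [MeasurableSpace K] [BorelSpace K]

variable (K) in
theorem secondCountable : SecondCountableTopology K :=
  let _ := TopologicalSpace.metrizableSpaceMetric K
  UniformSpace.secondCountable_of_separable K

theorem regular_of_finite (m : Measure K) [IsFiniteMeasure m] : m.Regular := by
  have := secondCountable K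
  let _ := TopologicalSpace.metrizableSpaceMetric K
  infer_instance

theorem measure_le_of_integral_le (m m' : Measure K) [IsFiniteMeasure m] [IsFiniteMeasure m']
    (h : ∀ φ : K → ℝ, Continuous φ → HasCompactSupport φ → (∀ x, 0 ≤ φ x) →
      ∫ x, φ x ∂m ≤ ∫ x, φ x ∂m') : m ≤ m' := by
  have := regular_of_finite m
  have := regular_of_finite m'
  refine Measure.le_iff.mpr fun B hB => ?_
  rw [hB.measure_eq_iSup_isCompact_of_ne_top (measure_ne_top m B), B.measure_eq_iInf_isOpen m']
  refine iSup₂_le fun C hCB => iSup_le fun hC => le_iInf₂ fun V hBV => le_iInf fun hV => ?_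
  obtain ⟨f, hf1, hf2, hf3⟩ := exists_continuousMap_one_of_isCompact_subset_isOpen hC hV
    (hCB.trans hBV)
  have hfi : ∀ (n : Measure K) [IsFiniteMeasure n], Integrable f n := fun n _ =>
    f.continuous.integrable_of_hasCompactSupport hf2
  have h1 : m.real C ≤ ∫ x, f x ∂m := by
    rw [← integral_indicator_one hC.measurableSet]
    refine integral_mono ((integrable_const 1).indicator hC.measurableSet) (hfi m) fun x => ?_
    exact Set.indicator_apply_le' (fun hx => (hf1 hx).ge) fun _ => (hf3.2 x).1
  have h2 : ∫ x, f x ∂m' ≤ m'.real V := by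
    rw [← integral_indicator_one hV.measurableSet]
    refine integral_mono (hfi m') ((integrable_const 1).indicator hV.measurableSet) fun x => ?_
    by_cases hx : x ∈ V
    · rw [Set.indicator_of_mem hx]; exact (hf3.2 x).2
    · rw [Set.indicator_of_notMem hx, image_eq_zero_of_notMem_tsupport fun h => hx (hf3.1 h)]
  have h3 := h1.trans ((h f f.continuous hf2 fun x => (hf3.2 x).1).trans h2)
  exact (ENNReal.toReal_le_toReal (measure_ne_top _ _) (measure_ne_top _ _)).mp h3

variable {μ : Measure K} [SigmaFinite μ] {E : DirichletForm μ}

theorem Core.integrable {φ : K → ℝ} (h : E.Core φ) (m : Measure K) [IsFiniteMeasure m] :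
    Integrable φ m :=
  h.continuous.integrable_of_hasCompactSupport h.compact

/-- Squares are the test functions for which strong locality evaluates the energy functional. They
suffice: √φ is a uniform limit of nonnegative functions of the core, although it need not belong to
the core itself. -/
theorem IsRegular.measure_le_of_sq (hE : E.IsRegular) (m m' : Measure K) [IsFiniteMeasure m]
    [IsFiniteMeasure m'] (h : ∀ φ : K → ℝ, E.Core φ → (∀ x, 0 ≤ φ x) →
      ∫ x, φ x ^ 2 ∂m ≤ ∫ x, φ x ^ 2 ∂m') : m ≤ m' := by
  refine measure_le_of_integral_le m m' fun φ h1 h2 h0 => ?_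
  have hs1 : Continuous fun x => Real.sqrt (φ x) := h1.sqrt
  have hs2 : HasCompactSupport fun x => Real.sqrt (φ x) :=
    h2.comp_left (g := Real.sqrt) Real.sqrt_zero
  obtain ⟨C, hC⟩ := hs1.bounded_above_of_compact_support hs2
  choose ψ hψ hψ0 hψφ using fun n : ℕ =>
    hE.exists_core_approx hs1 hs2 (fun x => Real.sqrt_nonneg _)
      (Nat.one_div_pos_of_nat (α := ℝ) (n := n))
  have hlim : ∀ (n : Measure K) [IsFiniteMeasure n],
      Tendsto (fun k => ∫ x, ψ k x ^ 2 ∂n) atTop (𝓝 (∫ x, φ x ∂n)) := by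
    intro n _
    refine tendsto_integral_of_dominated_convergence (fun _ => (C + 1) ^ 2)
      (fun k => ((hψ k).continuous.pow 2).aestronglyMeasurable) (integrable_const _)
      (fun k => Eventually.of_forall fun x => ?_) (Eventually.of_forall fun x => ?_)
    · have h3 := (abs_lt.mp (hψφ k x)).1
      have h4 := (le_abs_self _).trans (hC x)
      have h5 : (1 : ℝ) / (k + 1) ≤ 1 := by
        rw [div_le_one (by positivity)]; linarith [(Nat.cast_nonneg k : (0 : ℝ) ≤ k)]
      rw [Real.norm_eq_abs, abs_of_nonneg (sq_nonneg _)]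
      exact pow_le_pow_left₀ (hψ0 k x) (by linarith) 2
    · have h3 : Tendsto (fun k => ψ k x) atTop (𝓝 (Real.sqrt (φ x))) := by
        rw [tendsto_iff_norm_sub_tendsto_zero]
        refine squeeze_zero (fun _ => norm_nonneg _) (fun k => ?_)
          (tendsto_one_div_add_atTop_nhds_zero_nat (𝕜 := ℝ))
        rw [Real.norm_eq_abs, abs_sub_comm]; exact (hψφ k x).le
      simpa [Real.sq_sqrt (h0 x)] using h3.pow 2
  exact le_of_tendsto_of_tendsto' (hlim m) (hlim m') fun k => h _ (hψ k) (hψ0 k)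

theorem IsRegular.measure_eq (hE : E.IsRegular) (m m' : Measure K) [IsFiniteMeasure m]
    [IsFiniteMeasure m'] (h : ∀ φ : K → ℝ, E.Core φ → ∫ x, φ x ∂m = ∫ x, φ x ∂m') : m = m' := by
  have h2 : ∀ φ : K → ℝ, E.Core φ → ∫ x, φ x ^ 2 ∂m = ∫ x, φ x ^ 2 ∂m' := fun φ hφ => by
    simpa only [pow_two] using h _ (hφ.mul hφ)
  exact le_antisymm (hE.measure_le_of_sq m m' fun φ hφ _ => (h2 φ hφ).le)
    (hE.measure_le_of_sq m' m fun φ hφ _ => (h2 φ hφ).ge)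

end Compare

end DirichletForm
end

noncomputable section
namespace DirichletForm

/-! ### Energy measures of bounded functions by Riesz representation -/

section Existence

variable {K : Type*} [TopologicalSpace K]

/-- The inclusion of `C_c(K, ℝ)` in the bounded continuous functions. -/
def ccToBounded : C_c(K, ℝ) →ₗ[ℝ] BoundedContinuousFunction K ℝ where
  toFun φ := BoundedContinuousFunction.ofNormedAddCommGroup φ φ.continuous
    (φ.continuous.bounded_above_of_compact_support φ.hasCompactSupport).choose
    (φ.continuous.bounded_above_of_compact_support φ.hasCompactSupport).choose_spec
  map_add' φ ψ := by ext x; rfl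
  map_smul' r φ := by ext x; rfl

variable [LocallyCompactSpace K]
    [TopologicalSpace.SeparableSpace K] [TopologicalSpace.MetrizableSpace K]
    [MeasurableSpace K] [BorelSpace K] {μ : Measure K} [SigmaFinite μ] {E : DirichletForm μ}

variable (E) in
/-- The bounded continuous functions that belong to `F ∩ C₀(K)`. -/
def coreSubmodule : Submodule ℝ (BoundedContinuousFunction K ℝ) where
  carrier := {φ | E.Core φ}
  add_mem' h h' := h.add h'
  zero_mem' := ⟨continuous_const, HasCompactSupport.zero, dom_zero⟩
  smul_mem' r _ h := h.const_mul r

/-- Existence of the energy measure of a bounded function. -/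
theorem IsRegular.exists_bdd_measure (hE : E.IsRegular) {f : K → ℝ} (hf : E.Dom f) {M : ℝ}
    (hM : ∀ x, |f x| ≤ M) : ∃ m : Measure K, IsFiniteMeasure m ∧ m.real Set.univ ≤ 2 * E.en f f ∧
      ∀ φ, E.Core φ → ∫ x, φ x ∂m = E.energyFunctional f φ := by
  have hbd : ∀ (φ : BoundedContinuousFunction K ℝ) (x : K), |φ x| ≤ ‖φ‖ := fun φ x =>
    φ.norm_coe_le_norm x
  let Λ : E.coreSubmodule →ₗ[ℝ] ℝ :=
    { toFun := fun φ => E.energyFunctional f φ.1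
      map_add' := fun φ ψ => energyFunctional_add hf hM φ.2.dom (hbd _) ψ.2.dom (hbd _)
      map_smul' := fun r φ => energyFunctional_const_mul hf hM φ.2.dom (hbd _) r }
  have hb : ∀ φ, ‖Λ φ‖ ≤ 2 * E.en f f * ‖φ‖ := by
    intro φ
    have h1 := energyFunctional_le hf hM φ.2.dom (hbd φ.1) (norm_nonneg _)
    have h2 := energyFunctional_le hf hM (-φ).2.dom (hbd (-φ).1) (norm_nonneg _)
    have h3 : E.energyFunctional f (-φ).1 = -Λ φ := Λ.map_neg φ
    rw [h3, Submodule.coe_neg, norm_neg] at h2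
    change |Λ φ| ≤ 2 * E.en f f * ‖φ.1‖
    change Λ φ ≤ _ at h1
    rw [abs_le]
    constructor <;> linarith
  obtain ⟨g, hg, hgn⟩ := exists_extension_norm_eq E.coreSubmodule (Λ.mkContinuous _ hb)
  have hgle : ‖g‖ ≤ 2 * E.en f f := by
    rw [hgn]
    exact ContinuousLinearMap.opNorm_le_bound _ (mul_nonneg zero_le_two (en_self_nonneg f)) hb
  -- A norm-preserving extension need not be positive for free. Here a nonnegative φ is a uniform
  -- limit of nonnegative core functions, on which the functional is nonnegative.
  have hpos : ∀ φ : C_c(K, ℝ), 0 ≤ φ → 0 ≤ (g.toLinearMap ∘ₗ ccToBounded) φ := by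
    intro φ hφ
    refine le_of_forall_pos_le_add fun ε hε => ?_
    have hS : 0 < ε / (‖g‖ + 1) := by positivity
    obtain ⟨ψ, hψ, hψ0, hψφ⟩ := hE.exists_core_approx φ.continuous φ.hasCompactSupport
      (fun x => hφ x) hS
    set ψ' : BoundedContinuousFunction K ℝ := ccToBounded (toCc ψ hψ.continuous hψ.compact)
    have h1 : g ψ' = Λ ⟨ψ', hψ⟩ := hg ⟨ψ', hψ⟩
    have h2 : 0 ≤ Λ ⟨ψ', hψ⟩ := energyFunctional_nonneg hf hM hψ.dom (hbd ψ') hψ0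
    have h3 : ‖ψ' - ccToBounded φ‖ ≤ ε / (‖g‖ + 1) :=
      (BoundedContinuousFunction.norm_le hS.le).mpr fun x => by
        rw [BoundedContinuousFunction.sub_apply, Real.norm_eq_abs, abs_sub_comm]
        exact (hψφ x).le
    have h4 : |g (ψ' - ccToBounded φ)| ≤ ε := by
      refine (g.le_opNorm _).trans ?_
      calc ‖g‖ * ‖ψ' - ccToBounded φ‖ ≤ (‖g‖ + 1) * (ε / (‖g‖ + 1)) := by
            gcongr; linarith
        _ = ε := by field_simp
    rw [map_sub, h1] at h4
    change 0 ≤ g (ccToBounded φ) + ε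
    linarith [(abs_le.mp h4).2]
  let P : C_c(K, ℝ) →ₚ[ℝ] ℝ := PositiveLinearMap.mk₀ _ hpos
  have huniv : RealRMK.rieszMeasure P Set.univ ≤ ENNReal.ofReal (2 * E.en f f) := by
    rw [isOpen_univ.measure_eq_iSup_isCompact]
    refine iSup₂_le fun C _ => iSup_le fun hC => ?_
    obtain ⟨h, hf1, hf2, hf3⟩ := exists_continuousMap_one_of_isCompact_subset_isOpen hC
      isOpen_univ (Set.subset_univ C)
    refine (RealRMK.rieszMeasure_le_of_eq_one P (f := toCc h h.continuous hf2)
      (fun x => (hf3.2 x).1) hC fun x hx => hf1 hx).trans (ENNReal.ofReal_le_ofReal ?_)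
    refine (le_abs_self _).trans ((g.le_opNorm _).trans ?_)
    have h1 : ‖ccToBounded (toCc h h.continuous hf2)‖ ≤ 1 :=
      (BoundedContinuousFunction.norm_le zero_le_one).mpr fun x => by
        rw [Real.norm_eq_abs]
        exact abs_le.mpr ⟨(neg_nonpos.mpr zero_le_one).trans (hf3.2 x).1, (hf3.2 x).2⟩
    exact (mul_le_of_le_one_right (norm_nonneg _) h1).trans hgle
  have hfin : IsFiniteMeasure (RealRMK.rieszMeasure P) := ⟨huniv.trans_lt ENNReal.ofReal_lt_top⟩
  refine ⟨RealRMK.rieszMeasure P, hfin, ?_, fun φ hφ => ?_⟩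
  · exact ENNReal.toReal_le_of_le_ofReal (mul_nonneg zero_le_two (en_self_nonneg f)) huniv
  · rw [show ∫ x, φ x ∂(RealRMK.rieszMeasure P) = P (toCc φ hφ.continuous hφ.compact) from
      RealRMK.integral_rieszMeasure P (toCc φ hφ.continuous hφ.compact)]
    exact hg ⟨ccToBounded (toCc φ hφ.continuous hφ.compact), hφ⟩

end Existence

/-! ### Uniqueness, mass bound and parallelogram law for bounded functions -/

section Bounded

variable {K : Type*} [TopologicalSpace K] [LocallyCompactSpace K]
    [TopologicalSpace.SeparableSpace K] [TopologicalSpace.MetrizableSpace K]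
    [MeasurableSpace K] [BorelSpace K] {μ : Measure K} [SigmaFinite μ] {E : DirichletForm μ}

theorem IsBdd.exists_rep {F : E.domain} (h : E.IsBdd F) :
    ∃ (f : K → ℝ) (M : ℝ), (∀ x, |f x| ≤ M) ∧ ((F : Lp ℝ 2 μ) : K → ℝ) =ᵐ[μ] f := by
  obtain ⟨C, hC⟩ := h
  refine ⟨fun x => max (-|C|) (min ((F : Lp ℝ 2 μ) x) |C|), |C|, fun x => abs_le.mpr
    ⟨le_max_left _ _, max_le (by linarith [abs_nonneg C]) (min_le_right _ _)⟩, ?_⟩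
  filter_upwards [hC] with x hx
  have := abs_le.mp (hx.trans (le_abs_self C))
  rw [min_eq_left this.2, max_eq_right this.1]

theorem isBdd_of_rep {F : E.domain} {f : K → ℝ} {M : ℝ} (hM : ∀ x, |f x| ≤ M)
    (hf : ((F : Lp ℝ 2 μ) : K → ℝ) =ᵐ[μ] f) : E.IsBdd F :=
  ⟨M, by filter_upwards [hf] with x hx; rw [hx]; exact hM x⟩

/-- The defining property of the energy measure, in terms of a bounded representative. -/
theorem isBddEnergyMeasure_iff {F : E.domain} {f : K → ℝ} {M : ℝ} (hM : ∀ x, |f x| ≤ M)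
    (hf : ((F : Lp ℝ 2 μ) : K → ℝ) =ᵐ[μ] f) (m : Measure K) :
    E.IsBddEnergyMeasure F m ↔
      IsFiniteMeasure m ∧ ∀ φ, E.Core φ → ∫ x, φ x ∂m = E.energyFunctional f φ := by
  have hd : E.Dom f := ⟨F, hf⟩
  refine and_congr_right fun _ => ⟨fun h φ hφ => ?_, fun h φ g hg => ?_⟩
  · obtain ⟨u, v, hu, hv, huv⟩ := h (toCc φ hφ.continuous hφ.compact) (E.cls φ) hφ.dom.coe_cls
    have hu' : ((u : Lp ℝ 2 μ) : K → ℝ) =ᵐ[μ] fun x => f x * φ x := by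
      filter_upwards [hu, hf] with x h1 h2
      rw [h1, h2]; rfl
    have hv' : ((v : Lp ℝ 2 μ) : K → ℝ) =ᵐ[μ] fun x => f x ^ 2 := by
      filter_upwards [hv, hf] with x h1 h2
      rw [h1, h2]
    rw [energyFunctional, en, en, cls_eq hu', cls_eq hv', cls_eq hf]
    exact huv
  · have hφ : E.Core φ := ⟨φ.continuous, φ.hasCompactSupport, g, hg⟩
    obtain ⟨N, hN⟩ := hφ.bounded
    refine ⟨E.cls fun x => f x * φ x, E.cls fun x => f x ^ 2, ?_, ?_, ?_⟩
    · filter_upwards [(hd.mul hM hφ.dom hN).coe_cls, hf] with x h1 h2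
      rw [h1, h2]
    · filter_upwards [(hd.sq hM).coe_cls, hf] with x h1 h2
      rw [h1, h2]
    · rw [h φ hφ, energyFunctional, en, en, cls_eq hf, cls_eq hg]

theorem IsRegular.exists_isBddEnergyMeasure (hE : E.IsRegular) {F : E.domain} (h : E.IsBdd F) :
    ∃ m, E.IsBddEnergyMeasure F m := by
  obtain ⟨f, M, hM, hf⟩ := h.exists_rep
  obtain ⟨m, hm, -, hφ⟩ := hE.exists_bdd_measure ⟨F, hf⟩ hM
  exact ⟨m, (isBddEnergyMeasure_iff hM hf m).mpr ⟨hm, hφ⟩⟩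

theorem IsRegular.isBddEnergyMeasure_unique (hE : E.IsRegular) {F : E.domain} (h : E.IsBdd F)
    {m m' : Measure K} (hm : E.IsBddEnergyMeasure F m) (hm' : E.IsBddEnergyMeasure F m') :
    m = m' := by
  obtain ⟨f, M, hM, hf⟩ := h.exists_rep
  rw [isBddEnergyMeasure_iff hM hf] at hm hm'
  have := hm.1
  have := hm'.1
  exact hE.measure_eq m m' fun φ hφ => (hm.2 φ hφ).trans (hm'.2 φ hφ).symm

theorem IsRegular.isBddEnergyMeasure_real_le (hE : E.IsRegular) {F : E.domain} (h : E.IsBdd F)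
    {m : Measure K} (hm : E.IsBddEnergyMeasure F m) (B : Set K) :
    m.real B ≤ 2 * E.form F F := by
  obtain ⟨f, M, hM, hf⟩ := h.exists_rep
  obtain ⟨m', hm', hle, hφ⟩ := hE.exists_bdd_measure ⟨F, hf⟩ hM
  obtain rfl := hE.isBddEnergyMeasure_unique h hm
    ((isBddEnergyMeasure_iff hM hf m').mpr ⟨hm', hφ⟩)
  have := hm.1
  rw [en, cls_eq hf] at hle
  exact (measureReal_mono (Set.subset_univ B)).trans hle

theorem IsBdd.add {F G : E.domain} (h : E.IsBdd F) (h' : E.IsBdd G) : E.IsBdd (F + G) := by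
  obtain ⟨f, M, hM, hf⟩ := h.exists_rep
  obtain ⟨g, N, hN, hg⟩ := h'.exists_rep
  exact isBdd_of_rep (fun x => (abs_add_le _ _).trans (add_le_add (hM x) (hN x)))
    (coe_add_ae hf hg)

theorem IsBdd.smul {F : E.domain} (h : E.IsBdd F) (r : ℝ) : E.IsBdd (r • F) := by
  obtain ⟨f, M, hM, hf⟩ := h.exists_rep
  refine isBdd_of_rep (M := |r| * M) (fun x => ?_) (coe_smul_ae r hf)
  rw [abs_mul]
  exact mul_le_mul_of_nonneg_left (hM x) (abs_nonneg r)

theorem IsBdd.sub {F G : E.domain} (h : E.IsBdd F) (h' : E.IsBdd G) : E.IsBdd (F - G) := by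
  rw [sub_eq_add_neg, ← neg_one_smul ℝ]
  exact h.add (h'.smul _)

theorem IsRegular.isBddEnergyMeasure_parallelogram (hE : E.IsRegular) {F G : E.domain}
    (h : E.IsBdd F) (h' : E.IsBdd G) {s : ℝ} (hs : s ≠ 0) {m₁ m₂ m₃ m₄ : Measure K}
    (h₁ : E.IsBddEnergyMeasure (F + G) m₁) (h₂ : E.IsBddEnergyMeasure (s • F - s⁻¹ • G) m₂)
    (h₃ : E.IsBddEnergyMeasure F m₃) (h₄ : E.IsBddEnergyMeasure G m₄) (B : Set K) :
    m₁.real B + m₂.real B = (1 + s ^ 2) * m₃.real B + (1 + (s⁻¹) ^ 2) * m₄.real B := by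
  obtain ⟨f, M, hM, hf⟩ := h.exists_rep
  obtain ⟨g, N, hN, hg⟩ := h'.exists_rep
  have hfg := coe_add_ae hf hg
  have hfg' : (((s • F - s⁻¹ • G : E.domain) : Lp ℝ 2 μ) : K → ℝ) =ᵐ[μ]
      fun x => s * f x - s⁻¹ * g x := by
    rw [sub_eq_add_neg, ← neg_one_smul ℝ, smul_smul]
    refine (coe_add_ae (coe_smul_ae s hf) (coe_smul_ae _ hg)).trans
      (Eventually.of_forall fun x => ?_)
    simp only; ring
  rw [isBddEnergyMeasure_iff (fun x => (abs_add_le _ _).trans (add_le_add (hM x) (hN x))) hfg]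
    at h₁
  rw [isBddEnergyMeasure_iff (M := |s| * M + |s⁻¹| * N) (fun x => (abs_sub _ _).trans (by
    rw [abs_mul, abs_mul]
    gcongr
    · exact hM x
    · exact hN x)) hfg'] at h₂
  rw [isBddEnergyMeasure_iff hM hf] at h₃
  rw [isBddEnergyMeasure_iff hN hg] at h₄
  have := h₁.1
  have := h₂.1
  have := h₃.1
  have := h₄.1
  have key : m₁ + m₂ = (1 + s ^ 2).toNNReal • m₃ + (1 + (s⁻¹) ^ 2).toNNReal • m₄ := by
    refine hE.measure_eq _ _ fun φ hφ => ?_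
    obtain ⟨N', hN'⟩ := hφ.bounded
    rw [integral_add_measure (hφ.integrable _) (hφ.integrable _),
      integral_add_measure (hφ.integrable _) (hφ.integrable _),
      integral_smul_nnreal_measure, integral_smul_nnreal_measure, h₁.2 φ hφ, h₂.2 φ hφ,
      h₃.2 φ hφ, h₄.2 φ hφ]
    rw [NNReal.smul_def, NNReal.smul_def, Real.coe_toNNReal _ (by positivity),
      Real.coe_toNNReal _ (by positivity), smul_eq_mul, smul_eq_mul]
    exact energyFunctional_parallelogram ⟨F, hf⟩ hM ⟨G, hg⟩ hN hφ.dom hN' hs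
  have h5 := congrArg (fun m : Measure K => m.real B) key
  rw [measureReal_add_apply, measureReal_add_apply, measureReal_nnreal_smul_apply,
    measureReal_nnreal_smul_apply, Real.coe_toNNReal _ (by positivity),
    Real.coe_toNNReal _ (by positivity)] at h5
  exact h5

end Bounded

end DirichletForm
end

noncomputable section
namespace DirichletForm

/-! ### A Minkowski inequality and uniform setwise limits -/

section Limits

/-- At s² = √b/√a the right side of the hypothesis equals (√a + √b)². Adding ε/2 to both roots keeps
the quotient defined and positive. -/
theorem sqrt_le_sqrt_add_sqrt_of_forall {q a b : ℝ} (ha : 0 ≤ a) (hb : 0 ≤ b)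
    (h : ∀ s : ℝ, 0 < s → q ≤ (1 + s ^ 2) * a + (1 + (s⁻¹) ^ 2) * b) :
    Real.sqrt q ≤ Real.sqrt a + Real.sqrt b := by
  refine le_of_forall_pos_le_add fun ε hε => ?_
  set x := Real.sqrt a + ε / 2 with hx
  set y := Real.sqrt b + ε / 2 with hy
  have hx0 : 0 < x := by positivity
  have hy0 : 0 < y := by positivity
  have hax : a ≤ x ^ 2 := by
    rw [← Real.sq_sqrt ha]
    exact pow_le_pow_left₀ (Real.sqrt_nonneg _) (by linarith) 2
  have hby : b ≤ y ^ 2 := by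
    rw [← Real.sq_sqrt hb]
    exact pow_le_pow_left₀ (Real.sqrt_nonneg _) (by linarith) 2
  have h1 := h (Real.sqrt (y / x)) (Real.sqrt_pos.mpr (by positivity))
  rw [inv_pow, Real.sq_sqrt (by positivity)] at h1
  have h2 : q ≤ (x + y) ^ 2 := by
    calc q ≤ (1 + y / x) * a + (1 + (y / x)⁻¹) * b := h1
      _ ≤ (1 + y / x) * x ^ 2 + (1 + (y / x)⁻¹) * y ^ 2 := by gcongr
      _ = (x + y) ^ 2 := by field_simp; ring
  calc Real.sqrt q ≤ x + y := Real.sqrt_le_iff.mpr ⟨by positivity, h2⟩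
    _ = Real.sqrt a + Real.sqrt b + ε := by rw [hx, hy]; ring

theorem tendsto_sum_measureReal {K : Type*} [MeasurableSpace K] (m : Measure K)
    [IsFiniteMeasure m] (f : ℕ → Set K) (hf : ∀ i, MeasurableSet (f i))
    (hd : Pairwise (Function.onFun Disjoint f)) :
    Tendsto (fun n => ∑ i ∈ Finset.range n, m.real (f i)) atTop (𝓝 (m.real (⋃ i, f i))) := by
  have h := (m.toSignedMeasure.hasSum_of_disjoint_iUnion hf hd).tendsto_sum_nat
  simpa only [Measure.toSignedMeasure_apply_measurable (hf _),
    Measure.toSignedMeasure_apply_measurable (MeasurableSet.iUnion hf)] using h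

/-- A uniform setwise limit of finite measures is a finite measure. -/
theorem exists_measure_of_uniform_limit {K : Type*} [MeasurableSpace K] (m : ℕ → Measure K)
    (hm : ∀ n, IsFiniteMeasure (m n)) (L : Set K → ℝ)
    (h : ∀ ε > 0, ∃ N, ∀ n ≥ N, ∀ B, MeasurableSet B → |(m n).real B - L B| ≤ ε) :
    ∃ m' : Measure K, IsFiniteMeasure m' ∧ ∀ B, MeasurableSet B → m' B = ENNReal.ofReal (L B) := by
  have hlim : ∀ B, MeasurableSet B → Tendsto (fun n => (m n).real B) atTop (𝓝 (L B)) := by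
    intro B hB
    rw [Metric.tendsto_atTop]
    intro ε hε
    obtain ⟨N, hN⟩ := h (ε / 2) (by positivity)
    exact ⟨N, fun n hn => by rw [Real.dist_eq]; linarith [hN n hn B hB]⟩
  have h0 : ∀ B, MeasurableSet B → 0 ≤ L B := fun B hB =>
    ge_of_tendsto' (hlim B hB) fun _ => measureReal_nonneg
  have hempty : L ∅ = 0 := tendsto_nhds_unique (hlim ∅ MeasurableSet.empty) (by simp)
  have hfin : ∀ (f : ℕ → Set K), (∀ i, MeasurableSet (f i)) →
      Pairwise (Function.onFun Disjoint f) → ∀ k,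
      L (⋃ i ∈ Finset.range k, f i) = ∑ i ∈ Finset.range k, L (f i) := by
    intro f hf hd k
    refine tendsto_nhds_unique (hlim _ (Finset.measurableSet_biUnion _ fun i _ => hf i)) ?_
    have := tendsto_finsetSum (Finset.range k) fun i (_ : i ∈ Finset.range k) => hlim (f i) (hf i)
    refine this.congr fun n => ?_
    rw [measureReal_biUnion_finset (fun i _ j _ hij => hd hij) fun i _ => hf i]
  refine ⟨Measure.ofMeasurable (fun B _ => ENNReal.ofReal (L B)) (by simp [hempty]) ?_, ⟨?_⟩, ?_⟩
  · intro f hf hd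
    -- A single m N approximates L on the whole union and on every finite partial union, by
    -- uniformity in the set. Countable additivity of m N therefore passes to L.
    have hsum : HasSum (fun i => L (f i)) (L (⋃ i, f i)) := by
      rw [hasSum_iff_tendsto_nat_of_nonneg fun i => h0 _ (hf i), Metric.tendsto_atTop]
      intro ε hε
      obtain ⟨N, hN⟩ := h (ε / 4) (by positivity)
      have := hm N
      obtain ⟨k₀, hk₀⟩ := Metric.tendsto_atTop.mp (tendsto_sum_measureReal (m N) f hf hd) (ε / 4)
        (by positivity)
      refine ⟨k₀, fun k hk => ?_⟩
      have h1 := hN N le_rfl _ (MeasurableSet.iUnion hf)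
      have h2 := hN N le_rfl _ (Finset.measurableSet_biUnion (Finset.range k) fun i _ => hf i)
      have h3 := hk₀ k hk
      rw [Real.dist_eq] at h3 ⊢
      rw [hfin f hf hd, measureReal_biUnion_finset (fun i _ j _ hij => hd hij) fun i _ => hf i]
        at h2
      rw [abs_le] at h1 h2
      rw [abs_lt] at h3 ⊢
      constructor <;> linarith [h1.1, h1.2, h2.1, h2.2, h3.1, h3.2]
    rw [← hsum.tsum_eq, ENNReal.ofReal_tsum_of_nonneg (fun i => h0 _ (hf i)) hsum.summable]
  · rw [Measure.ofMeasurable_apply _ MeasurableSet.univ]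
    exact ENNReal.ofReal_lt_top
  · intro B hB
    rw [Measure.ofMeasurable_apply _ hB]

end Limits

/-! ### Energy measures of general elements of the domain -/

section General

variable {K : Type*} [TopologicalSpace K] [LocallyCompactSpace K]
    [TopologicalSpace.SeparableSpace K] [TopologicalSpace.MetrizableSpace K]
    [MeasurableSpace K] [BorelSpace K] {μ : Measure K} [SigmaFinite μ] {E : DirichletForm μ}

theorem tendsto_form₁_iff (g : ℕ → E.domain) (F : E.domain) :
    Tendsto (fun n => E.form₁ (g n - F) (g n - F)) atTop (𝓝 0) ↔
      Tendsto (fun n => ((E.toDom 1).symm (g n) : E.Hilb 1)) atTop (𝓝 ((E.toDom 1).symm F)) := by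
  have h1 : ∀ n, E.form₁ (g n - F) (g n - F) =
      ‖(E.toDom 1).symm (g n) - (E.toDom 1).symm F‖ ^ 2 := fun n => by
    rw [hilb_norm_sq, ← map_sub, LinearEquiv.apply_symm_apply, form₁, real_inner_self_eq_norm_sq,
      one_mul]
  simp only [h1]
  refine Iff.trans ⟨fun h => ?_, fun h => ?_⟩ tendsto_iff_norm_sub_tendsto_zero.symm
  · simpa using h.sqrt
  · simpa using h.pow 2

theorem form_le_form₁ (F : E.domain) : E.form F F ≤ E.form₁ F F :=
  le_add_of_nonneg_right real_inner_self_nonneg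

theorem form_sub_le (F G H : E.domain) :
    E.form (F - H) (F - H) ≤ 2 * E.form (F - G) (F - G) + 2 * E.form (H - G) (H - G) := by
  have h := E.nonneg ((F - G) + (H - G))
  have e : F - H = (F - G) - (H - G) := by abel
  rw [e]
  generalize F - G = x at *
  generalize H - G = y at *
  simp only [map_add, map_sub, LinearMap.add_apply, LinearMap.sub_apply] at h ⊢
  linarith [E.symm x y]

/-- Write F = G + (F - G) and drop the second, nonnegative measure in the weighted parallelogram
identity. Optimizing over the weight s gives a triangle inequality for the square roots, and the
measure of F - G has mass at most 2 E(F - G, F - G). -/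
theorem IsRegular.sqrt_sub_le (hE : E.IsRegular) {F G : E.domain} (h : E.IsBdd F)
    (h' : E.IsBdd G) {m m' : Measure K} (hm : E.IsBddEnergyMeasure F m)
    (hm' : E.IsBddEnergyMeasure G m') (B : Set K) :
    |Real.sqrt (m.real B) - Real.sqrt (m'.real B)| ≤
      Real.sqrt (2 * E.form (F - G) (F - G)) := by
  have key : ∀ (F G : E.domain) (m m' : Measure K), E.IsBdd F → E.IsBdd G →
      E.IsBddEnergyMeasure F m → E.IsBddEnergyMeasure G m' →
      Real.sqrt (m.real B) ≤ Real.sqrt (m'.real B) + Real.sqrt (2 * E.form (F - G) (F - G)) := by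
    intro F G m m' h h' hm hm'
    obtain ⟨d, hd⟩ := hE.exists_isBddEnergyMeasure (h.sub h')
    have h1 : Real.sqrt (m.real B) ≤ Real.sqrt (m'.real B) + Real.sqrt (d.real B) := by
      refine sqrt_le_sqrt_add_sqrt_of_forall measureReal_nonneg measureReal_nonneg fun s hs => ?_
      obtain ⟨e, he⟩ := hE.exists_isBddEnergyMeasure ((h'.smul s).sub ((h.sub h').smul s⁻¹))
      rw [← hE.isBddEnergyMeasure_parallelogram h' (h.sub h') hs.ne' (m₁ := m)
        (by rwa [add_sub_cancel]) he hm' hd B]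
      exact le_add_of_nonneg_right measureReal_nonneg
    exact h1.trans (by gcongr; exact hE.isBddEnergyMeasure_real_le (h.sub h') hd B)
  have h2 := key F G m m' h h' hm hm'
  have h3 := key G F m' m h' h hm' hm
  have h4 : E.form (G - F) (G - F) = E.form (F - G) (F - G) := by
    rw [← neg_sub F G, map_neg, map_neg, LinearMap.neg_apply, neg_neg]
  rw [h4] at h3
  rw [abs_le]
  constructor <;> linarith

theorem IsRegular.exists_core_seq (hE : E.IsRegular) (F : E.domain) :
    ∃ g : ℕ → E.domain, (∀ n, ∃ φ, E.Core φ ∧ ((g n : Lp ℝ 2 μ) : K → ℝ) =ᵐ[μ] φ) ∧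
      ∀ n : ℕ, E.form₁ (g n - F) (g n - F) ≤ 1 / ((n : ℝ) + 1) := by
  choose g φ hg hφ using fun n : ℕ =>
    hE.dense_in_domain F _ (Nat.one_div_pos_of_nat (α := ℝ) (n := n))
  refine ⟨g, fun n => ⟨φ n, ⟨(φ n).continuous, (φ n).hasCompactSupport, g n, hg n⟩, hg n⟩,
    fun n => ?_⟩
  have : g n - F = -(F - g n) := by abel
  rw [this, form₁]
  simp only [map_neg, LinearMap.neg_apply, neg_neg, Submodule.coe_neg, inner_neg_neg]
  exact (hφ n).le

theorem isBdd_of_core {F : E.domain} {φ : K → ℝ} (h : E.Core φ)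
    (hF : ((F : Lp ℝ 2 μ) : K → ℝ) =ᵐ[μ] φ) : E.IsBdd F := by
  obtain ⟨M, hM⟩ := h.bounded
  exact isBdd_of_rep hM hF

/-- Along a core sequence the square roots of the masses of B are Cauchy at a rate independent of B.
The masses are bounded, so they are uniformly Cauchy too and the setwise limit is a measure. -/
theorem IsRegular.exists_isEnergyMeasure (hE : E.IsRegular) (F : E.domain) :
    ∃ m, E.IsEnergyMeasure F m := by
  obtain ⟨g, hg, hgF⟩ := hE.exists_core_seq F
  have hb : ∀ n, E.IsBdd (g n) := fun n => by
    obtain ⟨φ, h1, h2⟩ := hg n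
    exact isBdd_of_core h1 h2
  choose ν hν using fun n => hE.exists_isBddEnergyMeasure (hb n)
  have hνfin : ∀ n, IsFiniteMeasure (ν n) := fun n => (hν n).1
  have hle : ∀ n : ℕ, E.form (g n - F) (g n - F) ≤ 1 / ((n : ℝ) + 1) := fun n =>
    (form_le_form₁ _).trans (hgF n)
  set A := 2 * (2 + 2 * E.form F F) with hA
  have hnorm : ∀ n B, Real.sqrt ((ν n).real B) ≤ Real.sqrt A := fun n B => by
    refine Real.sqrt_le_sqrt ((hE.isBddEnergyMeasure_real_le (hb n) (hν n) B).trans ?_)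
    have h1 := form_sub_le (g n) F 0
    have h2 : E.form (0 - F) (0 - F) = E.form F F := by simp
    rw [sub_zero, h2] at h1
    have h3 : (1 : ℝ) / (n + 1) ≤ 1 := by
      rw [div_le_one (by positivity)]; linarith [(Nat.cast_nonneg n : (0 : ℝ) ≤ n)]
    linarith [hle n]
  -- A difference of masses factors as (√a - √b)(√a + √b). The sum is at most 2√A, and 8 = 2(2 + 2)
  -- comes from the mass bound and from `form_sub_le`.
  let δ : ℕ → ℝ := fun N => Real.sqrt (8 * (1 / ((N : ℝ) + 1))) * (2 * Real.sqrt A)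
  have hδ : Tendsto δ atTop (𝓝 0) := by
    have := ((tendsto_one_div_add_atTop_nhds_zero_nat (𝕜 := ℝ)).const_mul 8).sqrt.mul_const
      (2 * Real.sqrt A)
    rwa [mul_zero, Real.sqrt_zero, zero_mul] at this
  have hcauchy : ∀ N, ∀ n ≥ N, ∀ k ≥ N, ∀ B, |(ν n).real B - (ν k).real B| ≤ δ N := by
    intro N n hn k hk B
    have h1 := hE.sqrt_sub_le (hb n) (hb k) (hν n) (hν k) B
    have h2 : Real.sqrt (2 * E.form (g n - g k) (g n - g k)) ≤
        Real.sqrt (8 * (1 / ((N : ℝ) + 1))) := by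
      refine Real.sqrt_le_sqrt ?_
      have h3 := form_sub_le (g n) F (g k)
      have h4 : (1 : ℝ) / (n + 1) ≤ 1 / (N + 1) := by gcongr
      have h5 : (1 : ℝ) / (k + 1) ≤ 1 / (N + 1) := by gcongr
      linarith [hle n, hle k]
    have h3 : (ν n).real B - (ν k).real B =
        (Real.sqrt ((ν n).real B) - Real.sqrt ((ν k).real B)) *
          (Real.sqrt ((ν n).real B) + Real.sqrt ((ν k).real B)) := by
      rw [mul_comm, ← sq_sub_sq, Real.sq_sqrt measureReal_nonneg, Real.sq_sqrt measureReal_nonneg]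
    rw [h3, abs_mul]
    refine mul_le_mul (h1.trans h2) ?_ (abs_nonneg _) (Real.sqrt_nonneg _)
    rw [abs_of_nonneg (by positivity)]
    linarith [hnorm n B, hnorm k B]
  have hlim : ∀ B, ∃ l, Tendsto (fun n => (ν n).real B) atTop (𝓝 l) := fun B => by
    refine cauchySeq_tendsto_of_complete (Metric.cauchySeq_iff.mpr fun ε hε => ?_)
    obtain ⟨N, hN⟩ := (hδ.eventually (gt_mem_nhds hε)).exists
    exact ⟨N, fun n hn k hk => (hcauchy N n hn k hk B).trans_lt hN⟩
  choose L hL using hlim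
  obtain ⟨m, hm, hmL⟩ := exists_measure_of_uniform_limit ν hνfin L (fun ε hε => by
    obtain ⟨N, hN⟩ := (hδ.eventually (gt_mem_nhds hε)).exists
    refine ⟨N, fun n hn B _ => ?_⟩
    have h1 : Tendsto (fun k => |(ν n).real B - (ν k).real B|) atTop (𝓝 |(ν n).real B - L B|) :=
      ((hL B).const_sub _).abs
    refine le_of_tendsto h1 ?_
    filter_upwards [eventually_ge_atTop N] with k hk
    exact (hcauchy N n hn k hk B).trans hN.le)
  refine ⟨m, hm, g, ν, hb, hν, ?_, fun B hB => ?_⟩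
  · exact squeeze_zero (fun n => (E.nonneg _).trans (form_le_form₁ _)) hgF
      tendsto_one_div_add_atTop_nhds_zero_nat
  · rw [hmL B hB]
    refine ((ENNReal.continuous_ofReal.tendsto _).comp (hL B)).congr fun n => ?_
    exact ENNReal.ofReal_toReal (measure_ne_top _ _)

theorem IsRegular.isEnergyMeasure (hE : E.IsRegular) (F : E.domain) :
    E.IsEnergyMeasure F (E.energyMeasure F) := by
  have h := hE.exists_isEnergyMeasure F
  rw [energyMeasure, dif_pos h]
  exact h.choose_spec

/-- The energy measure is the setwise limit along any approximating bounded sequence. -/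
theorem IsRegular.tendsto_energyMeasure (hE : E.IsRegular) {F : E.domain} {g : ℕ → E.domain}
    {ν : ℕ → Measure K} (hb : ∀ n, E.IsBdd (g n)) (hν : ∀ n, E.IsBddEnergyMeasure (g n) (ν n))
    (hg : Tendsto (fun n => E.form₁ (g n - F) (g n - F)) atTop (𝓝 0)) {B : Set K}
    (hB : MeasurableSet B) :
    Tendsto (fun n => (ν n).real B) atTop (𝓝 ((E.energyMeasure F).real B)) := by
  obtain ⟨-, g', ν', hb', hν', hg', hlim⟩ := hE.isEnergyMeasure F
  have h1 : Tendsto (fun n => (ν' n).real B) atTop (𝓝 ((E.energyMeasure F).real B)) :=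
    (ENNReal.tendsto_toReal (measure_ne_top _ _)).comp (hlim B hB)
  have h2 : Tendsto (fun n => Real.sqrt ((ν n).real B) - Real.sqrt ((ν' n).real B)) atTop
      (𝓝 0) := by
    have h3 : Tendsto (fun n => Real.sqrt (2 * (2 * E.form₁ (g n - F) (g n - F) +
        2 * E.form₁ (g' n - F) (g' n - F)))) atTop (𝓝 0) := by
      have := (((hg.const_mul 2).add (hg'.const_mul 2)).const_mul 2).sqrt
      simpa using this
    refine squeeze_zero_norm (fun n => ?_) h3
    refine (hE.sqrt_sub_le (hb n) (hb' n) (hν n) (hν' n) B).trans (Real.sqrt_le_sqrt ?_)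
    have := form_sub_le (g n) F (g' n)
    linarith [form_le_form₁ (g n - F), form_le_form₁ (g' n - F)]
  have h4 := (h2.add h1.sqrt).pow 2
  simpa [Real.sq_sqrt measureReal_nonneg] using h4

/-- The weighted parallelogram identity for energy measures. -/
theorem IsRegular.energyMeasure_parallelogram (hE : E.IsRegular) (F G : E.domain) {s : ℝ}
    (hs : s ≠ 0) {B : Set K} (hB : MeasurableSet B) :
    (E.energyMeasure (F + G)).real B + (E.energyMeasure (s • F - s⁻¹ • G)).real B =
      (1 + s ^ 2) * (E.energyMeasure F).real B + (1 + (s⁻¹) ^ 2) * (E.energyMeasure G).real B := by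
  obtain ⟨-, f, νf, hf, hνf, hfF, -⟩ := hE.isEnergyMeasure F
  obtain ⟨-, g, νg, hg, hνg, hgG, -⟩ := hE.isEnergyMeasure G
  choose ν₁ hν₁ using fun n => hE.exists_isBddEnergyMeasure ((hf n).add (hg n))
  choose ν₂ hν₂ using fun n =>
    hE.exists_isBddEnergyMeasure (((hf n).smul s).sub ((hg n).smul s⁻¹))
  have hfF' := (tendsto_form₁_iff f F).mp hfF
  have hgG' := (tendsto_form₁_iff g G).mp hgG
  have h1 := hE.tendsto_energyMeasure (F := F + G) (fun n => (hf n).add (hg n)) hν₁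
    ((tendsto_form₁_iff _ _).mpr (by simpa only [map_add] using hfF'.add hgG')) hB
  have h2 := hE.tendsto_energyMeasure (F := s • F - s⁻¹ • G)
    (fun n => ((hf n).smul s).sub ((hg n).smul s⁻¹)) hν₂
    ((tendsto_form₁_iff _ _).mpr (by
      simpa only [map_sub, map_smul] using (hfF'.const_smul s).sub (hgG'.const_smul s⁻¹))) hB
  have h3 := hE.tendsto_energyMeasure hf hνf hfF hB
  have h4 := hE.tendsto_energyMeasure hg hνg hgG hB
  refine tendsto_nhds_unique (h1.add h2) (((h3.const_mul _).add (h4.const_mul _)).congr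
    fun n => ?_)
  exact (hE.isBddEnergyMeasure_parallelogram (hf n) (hg n) hs (hν₁ n) (hν₂ n) (hνf n)
    (hνg n) B).symm

end General

end DirichletForm
end

noncomputable section
namespace DirichletForm

/-! ### Calculus of kernels -/

section Kernels

variable {K : Type*} [MeasurableSpace K] {μ : Measure K} {E : DirichletForm μ}

variable (E) in
/-- The kernel `S(x, y)` is a finite sum of products `a(x) b(y)` of functions in the domain, and
`q` is the sum of the corresponding `E(a, b)`. -/
def IsKernel (S : K → K → ℝ) (q : ℝ) : Prop :=
  ∃ (ι : Type) (_ : Fintype ι) (a b : ι → K → ℝ), (∀ i, E.Dom (a i)) ∧ (∀ i, E.Dom (b i)) ∧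
    (∀ x y, S x y = ∑ i, a i x * b i y) ∧ q = ∑ i, E.en (a i) (b i)

theorem isKernel_mul {a b : K → ℝ} (ha : E.Dom a) (hb : E.Dom b) :
    E.IsKernel (fun x y => a x * b y) (E.en a b) :=
  ⟨Unit, inferInstance, fun _ => a, fun _ => b, fun _ => ha, fun _ => hb, by simp, by simp⟩

theorem IsKernel.add {S T : K → K → ℝ} {q r : ℝ} (hS : E.IsKernel S q) (hT : E.IsKernel T r) :
    E.IsKernel (fun x y => S x y + T x y) (q + r) := by
  obtain ⟨ι, _, a, b, ha, hb, h1, h2⟩ := hS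
  obtain ⟨κ, _, c, d, hc, hd, h3, h4⟩ := hT
  refine ⟨ι ⊕ κ, inferInstance, Sum.elim a c, Sum.elim b d, ?_, ?_, ?_, ?_⟩
  · rintro (i | i)
    · exact ha i
    · exact hc i
  · rintro (i | i)
    · exact hb i
    · exact hd i
  · intro x y
    simp [Fintype.sum_sum_type, h1, h3]
  · simp [Fintype.sum_sum_type, h2, h4]

theorem IsKernel.const_mul {S : K → K → ℝ} {q : ℝ} (hS : E.IsKernel S q) (r : ℝ) :
    E.IsKernel (fun x y => r * S x y) (r * q) := by
  obtain ⟨ι, _, a, b, ha, hb, h1, h2⟩ := hS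
  refine ⟨ι, inferInstance, fun i x => r * a i x, b, fun i => (ha i).const_mul r, hb, ?_, ?_⟩
  · intro x y
    simp [h1, Finset.mul_sum, mul_assoc]
  · simp only [h2, Finset.mul_sum]
    exact Finset.sum_congr rfl fun i _ => (en_const_mul_left (ha i) r _).symm

theorem IsKernel.congr {S T : K → K → ℝ} {q r : ℝ} (hS : E.IsKernel S q)
    (h : ∀ x y, S x y = T x y) (hq : q = r) : E.IsKernel T r := by
  have : S = T := by funext x y; exact h x y
  rwa [← this, ← hq]

theorem isKernel_zero : E.IsKernel (fun _ _ => 0) 0 :=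
  (isKernel_mul dom_zero dom_zero (E := E)).const_mul 0 |>.congr (by simp) (by simp)

theorem isKernel_sum {S : ℕ → K → K → ℝ} {q : ℕ → ℝ} (h : ∀ j, E.IsKernel (S j) (q j)) (n : ℕ) :
    E.IsKernel (fun x y => ∑ j ∈ Finset.range n, S j x y) (∑ j ∈ Finset.range n, q j) := by
  induction n with
  | zero => simpa using isKernel_zero
  | succ n ih =>
    simp only [Finset.sum_range_succ]
    exact ih.add (h n)

theorem IsKernel.nonpos [SigmaFinite μ] {S : K → K → ℝ} {q : ℝ} (hS : E.IsKernel S q)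
    (h0 : ∀ x y, 0 ≤ S x y) (hd : ∀ x, S x x = 0) : q ≤ 0 := by
  obtain ⟨ι, _, a, b, ha, hb, h1, rfl⟩ := hS
  exact two_point_diag a b ha hb (fun x y => h1 x y ▸ h0 x y) (fun x => h1 x x ▸ hd x)

end Kernels

/-! ### Elementary inequalities -/

section RealLemmas

/-- The fourth power of a difference is bounded by a small multiple of its square, up to products
of functions with separated supports. -/
theorem exists_quartic_bound {M δ : ℝ} (hδ : 0 < δ) :
    ∃ (n : ℕ) (C : ℝ), ∀ y z : ℝ, |y| ≤ M → |z| ≤ M → (y - z) ^ 4 ≤ 16 * δ ^ 2 * (y - z) ^ 2 +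
      C * ∑ j ∈ Finset.range n,
        (max (y - (-M + (j + 1) * δ)) 0 * max ((-M + j * δ) - z) 0 +
         max ((-M + j * δ) - y) 0 * max (z - (-M + (j + 1) * δ)) 0) := by
  refine ⟨⌈2 * M / δ⌉₊ + 1, (2 * M) ^ 4 / δ ^ 2, ?_⟩
  set n := ⌈2 * M / δ⌉₊ + 1
  set C := (2 * M) ^ 4 / δ ^ 2
  have hC : 0 ≤ C := by positivity
  have main : ∀ y z : ℝ, |y| ≤ M → |z| ≤ M → z ≤ y → (y - z) ^ 4 ≤ 16 * δ ^ 2 * (y - z) ^ 2 +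
      C * ∑ j ∈ Finset.range n, max (y - (-M + (j + 1) * δ)) 0 * max ((-M + j * δ) - z) 0 := by
    intro y z hy hz hzy
    have hs : ∀ j : ℕ, 0 ≤ max (y - (-M + (j + 1) * δ)) 0 * max ((-M + j * δ) - z) 0 :=
      fun j => mul_nonneg (le_max_right _ _) (le_max_right _ _)
    rw [abs_le] at hy hz
    rcases le_total (y - z) (4 * δ) with h | h
    · have h1 : (y - z) ^ 2 ≤ 16 * δ ^ 2 := by nlinarith
      have h2 : (y - z) ^ 4 = (y - z) ^ 2 * (y - z) ^ 2 := by ring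
      rw [h2]
      have h3 := mul_le_mul_of_nonneg_right h1 (sq_nonneg (y - z))
      have h4 := mul_nonneg hC (Finset.sum_nonneg fun j (_ : j ∈ Finset.range n) => hs j)
      linarith
    -- If y - z ≥ 4δ, the index j = ⌊t⌋ + 2 makes both gaps at least δ: z lies at least δ below
    -- level j, and y at least δ above level j + 1. The product is at least δ², which C was chosen
    -- to raise to (2M)⁴.
    · set t := (z + M) / δ with ht
      have ht0 : 0 ≤ t := div_nonneg (by linarith) hδ.le
      have htδ : t * δ = z + M := div_mul_cancel₀ _ hδ.ne'
      have h1 := Nat.floor_le ht0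
      have h2 := Nat.lt_floor_add_one t
      have h3 : (⌊t⌋₊ : ℝ) * δ ≤ z + M := by rw [← htδ]; gcongr
      have h4 : z + M ≤ (⌊t⌋₊ + 1) * δ := by rw [← htδ]; gcongr
      have hj : ⌊t⌋₊ + 2 ∈ Finset.range n := by
        rw [Finset.mem_range]
        have h5 : ((⌊t⌋₊ + 2 : ℕ) : ℝ) ≤ 2 * M / δ := by
          rw [le_div_iff₀ hδ]; push_cast; nlinarith
        have := Nat.le_ceil (2 * M / δ)
        have h6 : ((⌊t⌋₊ + 2 : ℕ) : ℝ) ≤ (⌈2 * M / δ⌉₊ : ℝ) := h5.trans this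
        have h7 : ⌊t⌋₊ + 2 ≤ ⌈2 * M / δ⌉₊ := by exact_mod_cast h6
        exact Nat.lt_succ_of_le h7
      have h5 := Finset.single_le_sum (fun j (_ : j ∈ Finset.range n) => hs j) hj
      have h6 : δ * δ ≤ max (y - (-M + ((⌊t⌋₊ + 2 : ℕ) + 1) * δ)) 0 *
          max ((-M + (⌊t⌋₊ + 2 : ℕ) * δ) - z) 0 := by
        refine mul_le_mul ((le_max_left _ _).trans' ?_) ((le_max_left _ _).trans' ?_) hδ.le
          (le_max_right _ _)
        · push_cast; nlinarith
        · push_cast; nlinarith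
      have h7 : C * (δ * δ) ≤ C * ∑ j ∈ Finset.range n,
          max (y - (-M + (j + 1) * δ)) 0 * max ((-M + j * δ) - z) 0 :=
        mul_le_mul_of_nonneg_left (h6.trans h5) hC
      have h8 : C * (δ * δ) = (2 * M) ^ 4 := by simp only [C]; field_simp
      have h9 : (y - z) ^ 4 ≤ (2 * M) ^ 4 := pow_le_pow_left₀ (by linarith) (by linarith) 4
      have : 0 ≤ 16 * δ ^ 2 * (y - z) ^ 2 := by positivity
      linarith
  intro y z hy hz
  have hnn : ∀ a b : ℝ, 0 ≤ max a 0 * max b 0 := fun a b =>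
    mul_nonneg (le_max_right _ _) (le_max_right _ _)
  rcases le_total z y with h | h
  · refine (main y z hy hz h).trans ?_
    gcongr
    exact le_add_of_nonneg_right (hnn _ _)
  · have h1 : (y - z) ^ 4 = (z - y) ^ 4 := by ring
    have h2 : (y - z) ^ 2 = (z - y) ^ 2 := by ring
    rw [h1, h2]
    refine (main z y hz hy h).trans ?_
    gcongr
    rw [mul_comm]
    exact le_add_of_nonneg_left (hnn _ _)

/-- The coefficient of t⁴ is immaterial, because the quartic kernel will have the value 0. -/
theorem cos_le_quartic (t : ℝ) : Real.cos t ≤ 1 - t ^ 2 / 2 + t ^ 4 := by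
  rcases le_total |t| 1 with h | h
  · have h1 := (abs_le.mp (Real.cos_bound h)).2
    have h2 : |t| ^ 4 = t ^ 4 := by rw [← abs_pow]; exact abs_of_nonneg (by positivity)
    rw [h2] at h1
    nlinarith [show 0 ≤ t ^ 4 by positivity]
  · have h1 : 1 ≤ t ^ 2 := by rw [← sq_abs]; exact one_le_pow₀ h
    nlinarith [Real.cos_le_one t]

end RealLemmas

/-! ### Consequences of strong locality -/

section StrongLocal

variable {K : Type*} [TopologicalSpace K] [LocallyCompactSpace K]
    [TopologicalSpace.SeparableSpace K] [TopologicalSpace.MetrizableSpace K]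
    [MeasurableSpace K] [BorelSpace K] {μ : Measure K} [SigmaFinite μ] {E : DirichletForm μ}

theorem Core.supp_subset {φ : K → ℝ} (h : E.Core φ) : E.supp (E.cls φ) ⊆ tsupport φ := by
  refine Measure.support_subset_of_isClosed (isClosed_tsupport φ) ?_
  rw [mem_ae_iff, withDensity_apply _ (isClosed_tsupport φ).measurableSet.compl]
  rw [setLIntegral_congr_fun_ae (g := fun _ => 0) (isClosed_tsupport φ).measurableSet.compl]
  · simp
  · filter_upwards [h.dom.coe_cls] with x hx hxt
    rw [hx, image_eq_zero_of_notMem_tsupport hxt, enorm_zero]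

theorem Core.isCompact_supp {φ : K → ℝ} (h : E.Core φ) : IsCompact (E.supp (E.cls φ)) :=
  IsCompact.of_isClosed_subset h.compact Measure.isClosed_support h.supp_subset

theorem IsStrongLocal.en_eq_zero (hloc : E.IsStrongLocal) {φ γ : K → ℝ} (hφ : E.Core φ)
    (hγ : E.Core γ) {U : Set K} (hU : IsOpen U) (hφU : tsupport φ ⊆ U) {c : ℝ}
    (hc : ∀ x ∈ U, γ x = c) : E.en φ γ = 0 := by
  refine hloc _ _ hφ.isCompact_supp hγ.isCompact_supp ⟨U, c, hU, hφ.supp_subset.trans hφU, ?_⟩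
  filter_upwards [hγ.dom.coe_cls] with x hx hxU
  rw [hx, hc x hxU]

theorem IsRegular.exists_cutoff (hE : E.IsRegular) {C : Set K} (hC : IsCompact C) :
    ∃ (χ : K → ℝ) (U : Set K), E.Core χ ∧ (∀ x, 0 ≤ χ x) ∧ IsOpen U ∧ C ⊆ U ∧
      ∀ x ∈ U, χ x = 1 := by
  obtain ⟨C', hC', hCC'⟩ := exists_compact_superset hC
  obtain ⟨f, hf1, hf2, hf3⟩ := exists_continuousMap_one_of_isCompact_subset_isOpen hC'
    isOpen_univ (Set.subset_univ C')
  -- Approximating 2f within 1 makes ψ exceed 1 wherever f = 1, so truncation at height 1 gives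
  -- exactly 1 there.
  obtain ⟨ψ, hψ, hψ0, hψf⟩ := hE.exists_core_approx (φ := fun x => 2 * f x) (by fun_prop)
    (HasCompactSupport.mul_left (f := fun _ => (2 : ℝ)) hf2)
    (fun x => mul_nonneg zero_le_two (hf3.2 x).1) one_pos
  refine ⟨fun x => min (ψ x) 1, interior C', hψ.comp (T := fun t => min t 1) (L := 1)
    (by fun_prop) (by simp) (fun s t => by
      rw [one_mul]; exact abs_min_sub_min_le_max s 1 t 1 |>.trans (by simp)),
    fun x => le_min (hψ0 x) zero_le_one, isOpen_interior, hCC', fun x hx => min_eq_right ?_⟩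
  have h1 := (abs_lt.mp (hψf x)).2
  have h2 : f x = 1 := hf1 (interior_subset hx)
  rw [h2] at h1
  linarith

theorem Core.mul_comp {ψ f : K → ℝ} (hψ : E.Core ψ) (hf : E.Core f) {T : ℝ → ℝ} {L : ℝ}
    (hT : Continuous T) (hL : ∀ s t, |T s - T t| ≤ L * |s - t|) :
    E.Core fun x => ψ x * T (f x) := by
  have h1 : E.Core fun x => T (f x) - T 0 :=
    hf.comp (T := fun t => T t - T 0) (L := L) (by fun_prop) (sub_self _)
      fun s t => by simpa using hL s t
  have h2 := (hψ.mul h1).add (hψ.const_mul (T 0))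
  convert h2 using 2
  ring

theorem Core.mul_pow {ψ f : K → ℝ} (hψ : E.Core ψ) (hf : E.Core f) (k : ℕ) :
    E.Core fun x => ψ x * f x ^ k := by
  induction k with
  | zero => simpa using hψ
  | succ k ih =>
    convert ih.mul hf using 2
    ring

theorem isKernel_sq {ψ f : K → ℝ} (hψ : E.Core ψ) (hf : E.Core f) :
    E.IsKernel (fun x y => ψ x * ψ y * (f x - f y) ^ 2)
      (2 * E.en ψ (fun x => ψ x * f x ^ 2) -
        2 * E.en (fun x => ψ x * f x) (fun x => ψ x * f x)) := by
  have h1 := (hψ.mul hf).dom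
  have h2 := (hψ.mul_pow hf 2).dom
  refine ((isKernel_mul hψ.dom h2).add ((isKernel_mul h2 hψ.dom).add
    ((isKernel_mul h1 h1).const_mul (-2)))).congr (fun x y => by ring) ?_
  rw [en_comm _ ψ]
  ring

variable (E) in
/-- The value of the form on the kernel `ψ(x) ψ(y) (f(x) - f(y))⁴`. -/
def quartic (ψ f : K → ℝ) : ℝ :=
  2 * E.en ψ (fun x => ψ x * f x ^ 4) - 8 * E.en (fun x => ψ x * f x) (fun x => ψ x * f x ^ 3) +
    6 * E.en (fun x => ψ x * f x ^ 2) (fun x => ψ x * f x ^ 2)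

theorem isKernel_quartic {ψ f : K → ℝ} (hψ : E.Core ψ) (hf : E.Core f) :
    E.IsKernel (fun x y => ψ x * ψ y * (f x - f y) ^ 4) (E.quartic ψ f) := by
  have h1 := (hψ.mul hf).dom
  have h2 := (hψ.mul_pow hf 2).dom
  have h3 := (hψ.mul_pow hf 3).dom
  have h4 := (hψ.mul_pow hf 4).dom
  refine ((isKernel_mul hψ.dom h4).add ((isKernel_mul h4 hψ.dom).add
    (((isKernel_mul h1 h3).const_mul (-4)).add (((isKernel_mul h3 h1).const_mul (-4)).add
    ((isKernel_mul h2 h2).const_mul 6))))).congr (fun x y => by ring) ?_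
  rw [en_comm _ ψ, en_comm (fun x => ψ x * f x ^ 3), quartic]
  ring

/-- The two-point inequality gives one sign. For the other, the fourth power is at most 16δ² times
the square kernel plus products of functions with separated supports. Those products have zero
energy, and δ tends to 0. -/
theorem IsStrongLocal.quartic_eq_zero (hloc : E.IsStrongLocal) {ψ f : K → ℝ} (hψ : E.Core ψ)
    (hψ0 : ∀ x, 0 ≤ ψ x) (hf : E.Core f) : E.quartic ψ f = 0 := by
  refine le_antisymm ((isKernel_quartic hψ hf).nonpos (fun x y => ?_) fun x => by simp) ?_
  · have := hψ0 x
    have := hψ0 y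
    positivity
  obtain ⟨M, hM⟩ := hf.bounded
  have hM' : ∀ x, |f x| ≤ |M| := fun x => (hM x).trans (le_abs_self M)
  set q := 2 * E.en ψ (fun x => ψ x * f x ^ 2) -
        2 * E.en (fun x => ψ x * f x) (fun x => ψ x * f x) with hq
  have key : ∀ δ : ℝ, 0 < δ → 16 * δ ^ 2 * q ≤ E.quartic ψ f := by
    intro δ hδ
    obtain ⟨n, C, hn⟩ := exists_quartic_bound (M := |M|) hδ
    have hp : ∀ j : ℕ, E.Core fun x => ψ x * max (f x - (-|M| + (j + 1) * δ)) 0 := fun j =>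
      hψ.mul_comp hf (T := fun t => max (t - (-|M| + (j + 1) * δ)) 0) (L := 1) (by fun_prop)
        fun s t => by
          rw [one_mul]
          exact (abs_max_sub_max_le_abs _ _ _).trans (by simp)
    have hr : ∀ j : ℕ, E.Core fun x => ψ x * max ((-|M| + j * δ) - f x) 0 := fun j =>
      hψ.mul_comp hf (T := fun t => max ((-|M| + j * δ) - t) 0) (L := 1) (by fun_prop)
        fun s t => by
          rw [one_mul]
          refine (abs_max_sub_max_le_abs _ _ _).trans ?_
          rw [abs_sub_comm s t]; simp
    -- The first factor is supported in {f ≥ level j + 1}. The gap δ places this inside the open set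
    -- {f > level j}, where the second factor is constantly 0.
    have hz : ∀ j : ℕ, E.en (fun x => ψ x * max (f x - (-|M| + (j + 1) * δ)) 0)
        (fun x => ψ x * max ((-|M| + j * δ) - f x) 0) = 0 := by
      intro j
      refine hloc.en_eq_zero (hp j) (hr j) (U := {x | -|M| + j * δ < f x})
        (isOpen_lt continuous_const hf.continuous) ?_ (c := 0) fun x hx => ?_
      · have h1 : tsupport (fun x => ψ x * max (f x - (-|M| + (j + 1) * δ)) 0) ⊆
            {x | -|M| + (j + 1) * δ ≤ f x} := by
          refine closure_minimal (fun x hx => ?_) (isClosed_le continuous_const hf.continuous)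
          by_contra hlt
          simp only [Set.mem_ofPred_eq, not_le] at hlt
          exact hx (by simp only; rw [max_eq_right (by linarith), mul_zero])
        refine h1.trans fun x hx => ?_
        simp only [Set.mem_ofPred_eq] at hx ⊢
        linarith
      · simp only [Set.mem_ofPred_eq] at hx
        rw [max_eq_right (by linarith), mul_zero]
    have hker := ((isKernel_sq hψ hf).const_mul (16 * δ ^ 2)).add
      (((isKernel_sum (fun j => (isKernel_mul (hp j).dom (hr j).dom).add
        (isKernel_mul (hr j).dom (hp j).dom)) n).const_mul C).add
        ((isKernel_quartic hψ hf).const_mul (-1)))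
    have hle := hker.nonpos (fun x y => by
      have h1 := hn (f x) (f y) (hM' x) (hM' y)
      have h2 := mul_nonneg (hψ0 x) (hψ0 y)
      have h3 := mul_le_mul_of_nonneg_left h1 h2
      rw [mul_add, mul_left_comm _ C, Finset.mul_sum] at h3
      have h4 : ∀ j : ℕ, ψ x * ψ y *
        (max (f x - (-|M| + (j + 1) * δ)) 0 * max ((-|M| + j * δ) - f y) 0 +
         max ((-|M| + j * δ) - f x) 0 * max (f y - (-|M| + (j + 1) * δ)) 0) =
         ψ x * max (f x - (-|M| + (j + 1) * δ)) 0 * (ψ y * max ((-|M| + j * δ) - f y) 0) +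
         ψ x * max ((-|M| + j * δ) - f x) 0 * (ψ y * max (f y - (-|M| + (j + 1) * δ)) 0) :=
        fun j => by ring
      simp only [h4] at h3
      linarith) (fun x => by
      have h4 : ∀ j : ℕ,
         ψ x * max (f x - (-|M| + (j + 1) * δ)) 0 * (ψ x * max ((-|M| + j * δ) - f x) 0) = 0 := by
        intro j
        rcases le_total (f x) (-|M| + (j + 1) * δ) with h | h
        · rw [max_eq_right (sub_nonpos.mpr h)]; ring
        · rw [max_eq_right (a := -|M| + j * δ - f x) (by linarith)]; ring
      have h5 : ∀ j : ℕ,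
         ψ x * max ((-|M| + j * δ) - f x) 0 * (ψ x * max (f x - (-|M| + (j + 1) * δ)) 0) = 0 := by
        intro j; rw [mul_comm]; exact h4 j
      simp [h4, h5])
    have h6 : ∀ j : ℕ, E.en (fun x => ψ x * max ((-|M| + j * δ) - f x) 0)
        (fun x => ψ x * max (f x - (-|M| + (j + 1) * δ)) 0) = 0 := fun j => by
      rw [en_comm]; exact hz j
    simp only [hz, h6, add_zero, Finset.sum_const_zero, mul_zero, zero_add] at hle
    linarith
  have hlim : Tendsto (fun n : ℕ => 16 * (1 / ((n : ℝ) + 1)) ^ 2 * q) atTop (𝓝 0) := by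
    have := (((tendsto_one_div_add_atTop_nhds_zero_nat (𝕜 := ℝ)).pow 2).const_mul 16).mul_const q
    simpa using this
  exact le_of_tendsto' hlim fun n => key _ (by positivity)

/-- The cosine and sine products add up to φ(x)φ(y) cos(l(f(x) - f(y))). Since t²/2 - t⁴ ≤ 1 - cos t
≤ t²/2, the two-point inequality applies on both sides, and the error has value 0 by
`quartic_eq_zero`. -/
theorem IsStrongLocal.trig_identity (hloc : E.IsStrongLocal) {φ f : K → ℝ} (hφ : E.Core φ)
    (hφ0 : ∀ x, 0 ≤ φ x) (hf : E.Core f) (l : ℝ) :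
    E.en (fun x => φ x * Real.cos (l * f x)) (fun x => φ x * Real.cos (l * f x)) +
      E.en (fun x => φ x * Real.sin (l * f x)) (fun x => φ x * Real.sin (l * f x)) =
    E.en φ φ + l ^ 2 * (E.en (fun x => φ x * f x) (fun x => φ x * f x) -
      E.en φ (fun x => φ x * f x ^ 2)) := by
  have hc : E.Core fun x => φ x * Real.cos (l * f x) :=
    hφ.mul_comp hf (T := fun t => Real.cos (l * t)) (L := |l|) (by fun_prop) fun s t => by
      rw [← abs_mul, mul_sub]
      exact Real.abs_cos_sub_cos_le _ _
  have hs : E.Core fun x => φ x * Real.sin (l * f x) :=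
    hφ.mul_comp hf (T := fun t => Real.sin (l * t)) (L := |l|) (by fun_prop) fun s t => by
      rw [← abs_mul, mul_sub]
      exact Real.abs_sin_sub_sin_le _ _
  have hcos := (isKernel_mul hφ.dom hφ.dom).add
    (((isKernel_mul hc.dom hc.dom).add (isKernel_mul hs.dom hs.dom)).const_mul (-1))
  have hS : ∀ x y, φ x * φ y + (-1) * (φ x * Real.cos (l * f x) * (φ y * Real.cos (l * f y)) +
      φ x * Real.sin (l * f x) * (φ y * Real.sin (l * f y))) =
      φ x * φ y * (1 - Real.cos (l * (f x - f y))) := fun x y => by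
    rw [mul_sub l, Real.cos_sub]; ring
  have h1 := (((isKernel_sq hφ hf).const_mul (l ^ 2 / 2)).add (hcos.const_mul (-1))).nonpos
    (fun x y => by
      rw [hS]
      have h := Real.one_sub_sq_div_two_le_cos (x := l * (f x - f y))
      nlinarith [mul_nonneg (hφ0 x) (hφ0 y)])
    (fun x => by rw [hS]; simp)
  have h2 := ((((isKernel_sq hφ hf).const_mul (-(l ^ 2 / 2))).add hcos).add
    ((isKernel_quartic hφ hf).const_mul (l ^ 4))).nonpos
    (fun x y => by
      rw [hS]
      have h := cos_le_quartic (l * (f x - f y))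
      have h' := mul_nonneg (mul_nonneg (hφ0 x) (hφ0 y)) (sub_nonneg.mpr h)
      nlinarith [h'])
    (fun x => by rw [hS]; simp)
  rw [hloc.quartic_eq_zero hφ hφ0 hf] at h2
  linarith

/-- For a strong local form, `∫ φ² dν_f` is given by a form that is defined by the energies of
products. -/
theorem IsStrongLocal.energyFunctional_sq (hloc : E.IsStrongLocal) (hE : E.IsRegular)
    {φ f : K → ℝ} (hφ : E.Core φ) (hf : E.Core f) :
    E.energyFunctional f (fun x => φ x ^ 2) =
      2 * (E.en (fun x => φ x * f x) (fun x => φ x * f x) -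
        E.en φ (fun x => φ x * f x ^ 2)) := by
  obtain ⟨ψ, U, hψ, hψ0, hU, hCU, hψ1⟩ := hE.exists_cutoff (hφ.compact.isCompact.union
    hf.compact.isCompact)
  have hcase : ∀ x, ψ x = 1 ∨ (φ x = 0 ∧ f x = 0) := fun x => by
    by_cases hx : x ∈ U
    · exact Or.inl (hψ1 x hx)
    · exact Or.inr ⟨image_eq_zero_of_notMem_tsupport fun h => hx (hCU (Or.inl h)),
        image_eq_zero_of_notMem_tsupport fun h => hx (hCU (Or.inr h))⟩
  have hφ2 : E.Core fun x => φ x ^ 2 := by simpa [pow_two] using hφ.mul hφ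
  have hf2 : E.Core fun x => f x ^ 2 := by simpa [pow_two] using hf.mul hf
  have hφf := hφ.mul hf
  have hφff := hφ.mul_pow hf 2
  have hφφf := hf.mul hφ2
  have hφφff := hφ2.mul_pow hf 2
  -- The expansion of (φ(x) - φ(y))²(f(x) - f(y))², with the cutoff ψ in place of the constant 1.
  -- Once this kernel is known to have value 0, its cross terms are the asserted identity.
  have hker := (isKernel_mul hφφff.dom hψ.dom).add ((isKernel_mul hψ.dom hφφff.dom).add
    (((isKernel_mul hφφf.dom hf.dom).const_mul (-2)).add
    (((isKernel_mul hf.dom hφφf.dom).const_mul (-2)).add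
    ((isKernel_mul hφ2.dom hf2.dom).add ((isKernel_mul hf2.dom hφ2.dom).add
    (((isKernel_mul hφff.dom hφ.dom).const_mul (-2)).add
    (((isKernel_mul hφ.dom hφff.dom).const_mul (-2)).add
    ((isKernel_mul hφf.dom hφf.dom).const_mul 4))))))))
  have hker' := hker.congr (T := fun x y => ψ x * ψ y * ((φ x - φ y) ^ 2 * (f x - f y) ^ 2))
    (fun x y => by
      rcases hcase x with hx | ⟨hx, hx'⟩ <;> rcases hcase y with hy | ⟨hy, hy'⟩ <;>
      simp only [*] <;> ring) rfl
  have hz : E.en (fun x => φ x ^ 2 * f x ^ 2) ψ = 0 := by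
    refine hloc.en_eq_zero hφφff hψ hU (fun x hx => hCU (Or.inl ?_)) hψ1
    refine closure_mono (fun y hy => ?_) hx
    intro h0
    exact hy (by simp [h0])
  have h1 := hker'.nonpos (fun x y => by
    have := hψ0 x
    have := hψ0 y
    positivity) (fun x => by simp)
  -- The product of squares is at most the mean of the two fourth powers, whose kernels have value
  -- 0.
  have h2 := ((hker'.const_mul (-1)).add (((isKernel_quartic hψ hφ).const_mul (1 / 2)).add
    ((isKernel_quartic hψ hf).const_mul (1 / 2)))).nonpos (fun x y => by
      have h3 := mul_nonneg (hψ0 x) (hψ0 y)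
      have h4 : (φ x - φ y) ^ 2 * (f x - f y) ^ 2 ≤
          1 / 2 * (φ x - φ y) ^ 4 + 1 / 2 * (f x - f y) ^ 4 := by
        nlinarith [sq_nonneg ((φ x - φ y) ^ 2 - (f x - f y) ^ 2)]
      nlinarith [mul_le_mul_of_nonneg_left h4 h3]) (fun x => by simp)
  rw [hloc.quartic_eq_zero hψ hψ0 hφ, hloc.quartic_eq_zero hψ hψ0 hf] at h2
  rw [hz, en_comm ψ, hz, en_comm f, en_comm (fun x => f x ^ 2), en_comm _ φ] at h1 h2
  rw [energyFunctional]
  linarith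

end StrongLocal

end DirichletForm
end

noncomputable section
namespace DirichletForm

/-! ### Rank and quadratic forms -/

section LinearAlgebra

/-- Comparable positive semidefinite matrices: the smaller one has the smaller rank. -/
theorem rank_le_rank_of_quadratic_le {N : ℕ} {A B : Matrix (Fin N) (Fin N) ℝ} (hA : A.IsSymm)
    {C : ℝ} (h0 : ∀ a : Fin N → ℝ, 0 ≤ ∑ i, ∑ j, a i * a j * A i j)
    (hAB : ∀ a : Fin N → ℝ, ∑ i, ∑ j, a i * a j * A i j ≤ C * ∑ i, ∑ j, a i * a j * B i j) :
    A.rank ≤ B.rank := by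
  have hq : ∀ (M : Matrix (Fin N) (Fin N) ℝ) (a : Fin N → ℝ),
      star a ⬝ᵥ (M.mulVec a) = ∑ i, ∑ j, a i * a j * M i j := by
    intro M a
    simp only [dotProduct, Matrix.mulVec, Finset.mul_sum, star_trivial]
    exact Finset.sum_congr rfl fun i _ => Finset.sum_congr rfl fun j _ => by ring
  have hpsd : A.PosSemidef := Matrix.PosSemidef.of_dotProduct_mulVec_nonneg
    (by rw [Matrix.IsHermitian, Matrix.conjTranspose_eq_transpose_of_trivial]; exact hA)
    fun a => by rw [hq]; exact h0 a
  -- If Ba = 0, the quadratic form of A vanishes at a. For a positive semidefinite A this means Aa =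
  -- 0.
  have hker : LinearMap.ker B.mulVecLin ≤ LinearMap.ker A.mulVecLin := by
    intro a ha
    rw [LinearMap.mem_ker, Matrix.mulVecLin_apply] at ha ⊢
    rw [← hpsd.dotProduct_mulVec_zero_iff, hq]
    refine le_antisymm ((hAB a).trans ?_) (h0 a)
    rw [← hq, ha, dotProduct_zero, mul_zero]
  have h1 := LinearMap.finrank_range_add_finrank_ker A.mulVecLin
  have h2 := LinearMap.finrank_range_add_finrank_ker B.mulVecLin
  have h3 := Submodule.finrank_mono hker
  rw [Matrix.rank, Matrix.rank]
  omega

/-- Lower semicontinuity of the rank makes the rank of the density matrix a measurable function of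
the point. -/
theorem isOpen_lt_rank (N k : ℕ) : IsOpen {A : Matrix (Fin N) (Fin N) ℝ | k < A.rank} := by
  let T : Matrix (Fin N) (Fin N) ℝ →ₗ[ℝ] ((Fin N → ℝ) →L[ℝ] (Fin N → ℝ)) :=
    LinearMap.toContinuousLinearMap.toLinearMap ∘ₗ Matrix.toLin'.toLinearMap
  have hT : Continuous T := T.continuous_of_finiteDimensional
  have h := (isOpen_setOfPred_nat_le_rank (𝕜 := ℝ) (E := Fin N → ℝ)
    (F := Fin N → ℝ) (k + 1)).preimage hT
  convert h using 1
  ext A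
  simp only [Set.mem_preimage, Set.mem_ofPred_eq, Matrix.rank, LinearMap.rank]
  rw [← Module.finrank_eq_rank, Nat.cast_le, Nat.succ_le_iff]
  exact Iff.rfl

/-- Values of an abstract quadratic form at rational combinations. -/
theorem quadratic_sum {V : Type*} [AddCommGroup V] [Module ℝ V] (q : V → ℝ)
    (hq : ∀ f g, q (f + g) + q (f - g) = 2 * q f + 2 * q g) {N : ℕ} (f : Fin N → V)
    (a : Fin N → ℚ) :
    q (∑ i, (a i : ℝ) • f i) =
      ∑ i, ∑ j, (a i : ℝ) * a j * ((q (f i + f j) - q (f i) - q (f j)) / 2) := by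
  have h0 : q 0 = 0 := by
    have := hq 0 0
    simp only [add_zero, sub_zero] at this
    linarith
  -- The Jordan–von Neumann argument: four parallelogram laws combine so that the polarization is
  -- additive in each slot.
  have h3 : ∀ f g h, q (f + g + h) = q (f + g) + q (f + h) + q (g + h) - q f - q g - q h := by
    intro f g h
    have e1 := hq (f + g) h
    have e2 := hq (f + h) g
    have e3 := hq f (g - h)
    have e4 := hq g h
    have a1 : f + h + g = f + g + h := by abel
    have a2 : f + h - g = f - (g - h) := by abel
    have a3 : f + (g - h) = f + g - h := by abel
    rw [a1, a2] at e2
    rw [a3] at e3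
    linarith
  let P : V →+ V →+ ℝ := AddMonoidHom.mk' (fun f => AddMonoidHom.mk'
    (fun g => (q (f + g) - q f - q g) / 2) (fun g h => by
      have := h3 f g h
      rw [← add_assoc]
      linarith)) (fun f g => by
      ext h
      have := h3 f g h
      simp only [AddMonoidHom.mk'_apply, AddMonoidHom.add_apply]
      linarith)
  have hP : ∀ f g, P f g = (q (f + g) - q f - q g) / 2 := fun f g => rfl
  have hd : ∀ f, q f = P f f := fun f => by
    have := hq f f
    rw [sub_self, h0] at this
    rw [hP]; linarith
  -- Additive maps are linear over ℚ. No homogeneity or continuity of q is assumed, hence the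
  -- rational coefficients.
  have hs : ∀ (r : ℚ) (f g : V), P ((r : ℝ) • f) g = r * P f g := fun r f g => by
    have := map_ratCast_smul (P.flip g) ℝ ℝ r f
    simpa using this
  have hs' : ∀ (r : ℚ) (f g : V), P f ((r : ℝ) • g) = r * P f g := fun r f g => by
    have := map_ratCast_smul (P f) ℝ ℝ r g
    simpa using this
  rw [hd]
  simp only [map_sum, AddMonoidHom.finsetSum_apply]
  rw [Finset.sum_comm]
  refine Finset.sum_congr rfl fun i _ => ?_
  refine Finset.sum_congr rfl fun j _ => ?_
  rw [hs, hs', hP]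
  ring

theorem forall_real_of_forall_rat {N : ℕ} {A : Matrix (Fin N) (Fin N) ℝ}
    (h : ∀ a : Fin N → ℚ, 0 ≤ ∑ i, ∑ j, (a i : ℝ) * a j * A i j) (a : Fin N → ℝ) :
    0 ≤ ∑ i, ∑ j, a i * a j * A i j := by
  have hd : DenseRange fun a : Fin N → ℚ => fun i => (a i : ℝ) :=
    DenseRange.piMap fun _ => Rat.denseRange_cast
  refine hd.induction_on (p := fun a => 0 ≤ ∑ i, ∑ j, a i * a j * A i j) a ?_ h
  exact isClosed_le continuous_const (by fun_prop)

end LinearAlgebra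

/-! ### Essential suprema of families of extended natural numbers -/

section EssentialSupremum

variable {K : Type*} [MeasurableSpace K]

/-- A family of measurable sets has a countable subfamily whose union almost contains every
member. -/
theorem exists_countable_ae_cover (ν : Measure K) [SigmaFinite ν] {ι : Type*} (A : ι → Set K)
    (hA : ∀ i, MeasurableSet (A i)) :
    ∃ s : Set ι, s.Countable ∧ ∀ i, ∀ᵐ x ∂ν, x ∈ A i → ∃ j ∈ s, x ∈ A j := by
  set m := ν.toFinite
  -- A countable union of maximal mass for an equivalent finite measure cannot gain mass from any
  -- further member.
  let S : Set ENNReal := {r | ∃ s : Set ι, s.Countable ∧ r = m (⋃ j ∈ s, A j)}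
  have hne : S.Nonempty := ⟨_, ∅, Set.countable_empty, rfl⟩
  obtain ⟨r, -, hr, hrS⟩ := exists_seq_tendsto_sSup hne (OrderTop.bddAbove S)
  choose s hs hrs using hrS
  have hsc : (⋃ n, s n).Countable := Set.countable_iUnion hs
  have hmax : m (⋃ j ∈ ⋃ n, s n, A j) = sSup S := by
    refine le_antisymm (le_sSup ⟨_, hsc, rfl⟩) (le_of_tendsto' hr fun n => ?_)
    rw [hrs n]
    exact measure_mono (Set.biUnion_subset_biUnion_left (Set.subset_iUnion s n))
  have hmeas : MeasurableSet (⋃ j ∈ ⋃ n, s n, A j) := MeasurableSet.biUnion hsc fun j _ => hA j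
  refine ⟨⋃ n, s n, hsc, fun i => ?_⟩
  have h1 : m (⋃ j ∈ insert i (⋃ n, s n), A j) ≤ m (⋃ j ∈ ⋃ n, s n, A j) := by
    rw [hmax]
    exact le_sSup ⟨_, hsc.insert i, rfl⟩
  rw [Set.biUnion_insert] at h1
  have h2 : m (A i \ ⋃ j ∈ ⋃ n, s n, A j) = 0 := by
    have h3 : m (A i ∪ ⋃ j ∈ ⋃ n, s n, A j) =
        m (⋃ j ∈ ⋃ n, s n, A j) + m (A i \ ⋃ j ∈ ⋃ n, s n, A j) := by
      rw [← measure_union Set.disjoint_sdiff_right ((hA i).diff hmeas), Set.union_sdiff_self,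
        Set.union_comm]
    rw [h3] at h1
    have h4 : m (⋃ j ∈ ⋃ n, s n, A j) + m (A i \ ⋃ j ∈ ⋃ n, s n, A j) ≤
      m (⋃ j ∈ ⋃ n, s n, A j) + 0 := by rwa [add_zero]
    exact le_antisymm ((ENNReal.add_le_add_iff_left (measure_ne_top _ _)).mp h4) zero_le
  have h3 := absolutelyContinuous_toFinite ν h2
  rw [← compl_compl (A i \ _), ← mem_ae_iff] at h3
  filter_upwards [h3] with x hx hxi
  by_contra hcon
  refine hx ⟨hxi, fun hmem => hcon ?_⟩
  simpa only [Set.mem_iUnion, exists_prop] using hmem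

theorem measurable_of_measurableSet_lt {p : K → ℕ∞}
    (h : ∀ n : ℕ, MeasurableSet {x | (n : ℕ∞) < p x}) : Measurable p := by
  rw [ENat.measurable_iff]
  intro n
  have hle : MeasurableSet {x | (n : ℕ∞) ≤ p x} := by
    cases n with
    | zero => simp
    | succ n =>
      convert h n using 2
      funext x
      rw [Nat.cast_succ, ENat.add_one_le_iff (ENat.natCast_ne_top n)]
  convert hle.diff (h n) using 1
  ext x
  simp only [Set.mem_preimage, Set.mem_singleton_iff, Set.mem_sdiff, Set.mem_ofPred_eq, not_lt]
  exact ⟨fun hx => ⟨hx.ge, hx.le⟩, fun hx => le_antisymm hx.2 hx.1⟩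

/-- The essential supremum of a family of extended natural numbers. -/
theorem exists_essential_iSup (ν : Measure K) [SigmaFinite ν] {ι : Type*} (R : ι → K → ℕ∞)
    (hR : ∀ i (n : ℕ), MeasurableSet {x | (n : ℕ∞) < R i x}) :
    ∃ p : K → ℕ∞, Measurable p ∧ (∀ i, R i ≤ᵐ[ν] p) ∧
      ∀ p' : K → ℕ∞, (∀ i, R i ≤ᵐ[ν] p') → p ≤ᵐ[ν] p' := by
  -- Each level set {n < R i} gets its own countable cover. There are countably many levels, so one
  -- countable set of indices serves for all.
  choose s hs hcov using fun n : ℕ => exists_countable_ae_cover ν _ fun i => hR i n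
  have hsc : (⋃ n, s n).Countable := Set.countable_iUnion hs
  refine ⟨fun x => ⨆ j ∈ ⋃ n, s n, R j x, measurable_of_measurableSet_lt fun n => ?_,
    fun i => ?_, fun p' hp' => ?_⟩
  · have : {x | (n : ℕ∞) < ⨆ j ∈ ⋃ n, s n, R j x} = ⋃ j ∈ ⋃ n, s n, {x | (n : ℕ∞) < R j x} := by
      ext x
      simp only [lt_iSup_iff, Set.mem_iUnion, Set.mem_ofPred_eq]
    rw [this]
    exact MeasurableSet.biUnion hsc fun j _ => hR j n
  · filter_upwards [ae_all_iff.mpr fun n => hcov n i] with x hx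
    refine le_of_forall_lt fun c hc => ?_
    obtain ⟨n, rfl⟩ := ENat.ne_top_iff_exists.mp (ne_top_of_lt hc)
    obtain ⟨j, hj, hj'⟩ := hx n hc
    exact lt_of_lt_of_le hj' (le_iSup₂ (f := fun j (_ : j ∈ ⋃ n, s n) => R j x) j
      (Set.mem_iUnion.mpr ⟨n, hj⟩))
  · filter_upwards [(ae_ball_iff hsc).mpr fun j _ => hp' j] with x hx
    exact iSup₂_le hx

end EssentialSupremum

end DirichletForm
end

noncomputable section
namespace DirichletForm

/-! ### Comparison of energy measures -/

section Comparison

variable {K : Type*} [TopologicalSpace K] [LocallyCompactSpace K]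
    [TopologicalSpace.SeparableSpace K] [TopologicalSpace.MetrizableSpace K]
    [MeasurableSpace K] [BorelSpace K] {μ : Measure K} [SigmaFinite μ] {E E' : DirichletForm μ}

/-- Comparison of the energy measures of a function in `F ∩ C₀(K)`. -/
theorem energyFunctional_sq_le (hE : E.IsRegular) (hE' : E'.IsRegular) (hloc : E.IsStrongLocal)
    (hloc' : E'.IsStrongLocal) {c : ℝ} (hdom : ∀ u, E.Dom u → E'.Dom u)
    (hcomp : ∀ u, E.Dom u → E'.en u u ≤ c * E.en u u) {φ f : K → ℝ} (hφ : E.Core φ)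
    (hφ0 : ∀ x, 0 ≤ φ x) (hf : E.Core f) :
    E'.energyFunctional f (fun x => φ x ^ 2) ≤ c * E.energyFunctional f (fun x => φ x ^ 2) := by
  have hcore : ∀ {u}, E.Core u → E'.Core u := fun h => ⟨h.1, h.2, hdom _ h.3⟩
  rw [hloc.energyFunctional_sq hE hφ hf, hloc'.energyFunctional_sq hE' (hcore hφ) (hcore hf)]
  set D := E.en (fun x => φ x * f x) (fun x => φ x * f x) - E.en φ (fun x => φ x * f x ^ 2)
  set D' := E'.en (fun x => φ x * f x) (fun x => φ x * f x) - E'.en φ (fun x => φ x * f x ^ 2)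
  -- The form inequality on φ cos(lf) and φ sin(lf), summed. The bound does not depend on l, which
  -- forces D' ≤ cD.
  have key : ∀ l : ℝ, l ^ 2 * (D' - c * D) ≤ c * E.en φ φ - E'.en φ φ := by
    intro l
    have h1 := hloc.trig_identity hφ hφ0 hf l
    have h2 := hloc'.trig_identity (hcore hφ) hφ0 (hcore hf) l
    have h3 := hcomp _ (hφ.mul_comp hf (T := fun t => Real.cos (l * t)) (L := |l|) (by fun_prop)
      fun s t => by
        rw [← abs_mul, mul_sub]
        exact Real.abs_cos_sub_cos_le _ _).dom
    have h4 := hcomp _ (hφ.mul_comp hf (T := fun t => Real.sin (l * t)) (L := |l|) (by fun_prop)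
      fun s t => by
        rw [← abs_mul, mul_sub]
        exact Real.abs_sin_sub_sin_le _ _).dom
    linear_combination h3 + h4 + c * h1 - h2
  have hle : D' - c * D ≤ 0 := by
    by_contra! hpos
    set R := c * E.en φ φ - E'.en φ φ
    have h1 := key (Real.sqrt ((|R| + 1) / (D' - c * D)))
    rw [Real.sq_sqrt (by positivity), div_mul_cancel₀ _ hpos.ne'] at h1
    linarith [le_abs_self R]
  linarith

/-- Comparison of energy measures of comparable strong local Dirichlet forms. -/
theorem energyMeasure_real_le (hE : E.IsRegular) (hE' : E'.IsRegular) (hloc : E.IsStrongLocal)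
    (hloc' : E'.IsStrongLocal) {c : ℝ} (hc : 0 ≤ c) (T : E.domain ≃ₗ[ℝ] E'.domain)
    (hT : ∀ F, (T F : Lp ℝ 2 μ) = F) (hcomp : ∀ F, E'.form (T F) (T F) ≤ c * E.form F F)
    (F : E.domain) {B : Set K} (hB : MeasurableSet B) :
    (E'.energyMeasure (T F)).real B ≤ c * (E.energyMeasure F).real B := by
  have hcoe : ∀ {u : K → ℝ} {G : E.domain}, ((G : Lp ℝ 2 μ) : K → ℝ) =ᵐ[μ] u →
      ((T G : Lp ℝ 2 μ) : K → ℝ) =ᵐ[μ] u := fun {u G} h => by rwa [hT]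
  have hdom : ∀ u, E.Dom u → E'.Dom u := fun u h => ⟨T (E.cls u), hcoe h.coe_cls⟩
  have hen : ∀ u, E.Dom u → E'.en u u ≤ c * E.en u u := fun u h => by
    rw [en, cls_eq (hcoe h.coe_cls)]
    exact hcomp _
  have hcore : ∀ {u}, E.Core u → E'.Core u := fun h => ⟨h.1, h.2, hdom _ h.3⟩
  obtain ⟨g, hg, hgF⟩ := hE.exists_core_seq F
  have hb : ∀ n, E.IsBdd (g n) := fun n => by
    obtain ⟨φ, h1, h2⟩ := hg n
    exact isBdd_of_core h1 h2
  have hb' : ∀ n, E'.IsBdd (T (g n)) := fun n => by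
    obtain ⟨φ, h1, h2⟩ := hg n
    exact isBdd_of_core (hcore h1) (hcoe h2)
  choose m hm using fun n => hE.exists_isBddEnergyMeasure (hb n)
  choose m' hm' using fun n => hE'.exists_isBddEnergyMeasure (hb' n)
  have hle : ∀ n, (m' n).real B ≤ c * (m n).real B := by
    intro n
    obtain ⟨f, hf, hgf⟩ := hg n
    obtain ⟨M, hM⟩ := hf.bounded
    have h1 := (isBddEnergyMeasure_iff hM hgf (m n)).mp (hm n)
    have h2 := (isBddEnergyMeasure_iff hM (hcoe hgf) (m' n)).mp (hm' n)
    have := h1.1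
    have := h2.1
    have h3 : m' n ≤ c.toNNReal • m n := hE.measure_le_of_sq _ _ fun φ hφ hφ0 => by
      have hφ2 : E.Core fun x => φ x ^ 2 := by simpa [pow_two] using hφ.mul hφ
      rw [integral_smul_nnreal_measure, h1.2 _ hφ2, h2.2 _ (hcore hφ2), NNReal.smul_def,
        Real.coe_toNNReal c hc, smul_eq_mul]
      exact energyFunctional_sq_le hE hE' hloc hloc' hdom hen hφ hφ0 hf
    have h4 : (m' n).real B ≤ (c.toNNReal • m n).real B :=
      ENNReal.toReal_mono (measure_ne_top _ _) (h3 B)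
    rwa [measureReal_nnreal_smul_apply, Real.coe_toNNReal c hc] at h4
  have hconv : Tendsto (fun n => E.form₁ (g n - F) (g n - F)) atTop (𝓝 0) :=
    squeeze_zero (fun n => (E.nonneg _).trans (form_le_form₁ _)) hgF
      tendsto_one_div_add_atTop_nhds_zero_nat
  -- Comparability of the forms makes a core approximation for E also one for E', so the same
  -- sequence computes both energy measures.
  have hconv' : Tendsto (fun n => E'.form₁ (T (g n) - T F) (T (g n) - T F)) atTop (𝓝 0) := by
    have h1 := hconv.const_mul (c + 1)
    rw [mul_zero] at h1
    refine squeeze_zero (fun n => (E'.nonneg _).trans (form_le_form₁ _)) (fun n => ?_) h1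
    rw [← map_sub, form₁, hT, form₁]
    have h2 := hcomp (g n - F)
    have h3 := E.nonneg (g n - F)
    have h4 : 0 ≤ inner ℝ ((g n - F : E.domain) : Lp ℝ 2 μ) ((g n - F : E.domain) : Lp ℝ 2 μ) :=
      real_inner_self_nonneg
    nlinarith [mul_nonneg hc h4]
  exact le_of_tendsto_of_tendsto' (hE'.tendsto_energyMeasure hb' hm' hconv' hB)
    ((hE.tendsto_energyMeasure hb hm hconv hB).const_mul c) hle

end Comparison

/-! ### Density matrices and their ranks -/

section Density

variable {K : Type*} [TopologicalSpace K] [LocallyCompactSpace K]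
    [TopologicalSpace.SeparableSpace K] [TopologicalSpace.MetrizableSpace K]
    [MeasurableSpace K] [BorelSpace K] {μ : Measure K} [SigmaFinite μ] {E E' : DirichletForm μ}

variable (E) in
/-- The density of the energy measure of `F` with respect to `ν`. -/
def density (ν : Measure K) (F : E.domain) (x : K) : ℝ := ((E.energyMeasure F).rnDeriv ν x).toReal

theorem integrable_density (ν : Measure K) (F : E.domain) : Integrable (E.density ν F) ν :=
  Measure.integrable_toReal_rnDeriv

theorem setIntegral_density {ν : Measure K} [SigmaFinite ν] {F : E.domain}
    (h : E.energyMeasure F ≪ ν) (B : Set K) :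
    ∫ x in B, E.density ν F x ∂ν = (E.energyMeasure F).real B :=
  Measure.setIntegral_toReal_rnDeriv h B

theorem rnDeriv_mutualEnergyMeasure {ν : Measure K} [SigmaFinite ν]
    (h : ∀ F : E.domain, E.energyMeasure F ≪ ν) (F G : E.domain) :
    (E.mutualEnergyMeasure F G).rnDeriv ν =ᵐ[ν]
      fun x => (E.density ν (F + G) x - E.density ν F x - E.density ν G x) / 2 := by
  have hi : Integrable
      (fun x => (E.density ν (F + G) x - E.density ν F x - E.density ν G x) / 2) ν :=
    (((integrable_density ν (F + G)).sub (integrable_density ν F)).sub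
      (integrable_density ν G)).div_const 2
  refine (SignedMeasure.eq_rnDeriv 0 _ hi VectorMeasure.MutuallySingular.zero_left ?_).symm
  rw [zero_add]
  ext B hB
  rw [withDensityᵥ_apply hi hB, integral_div, integral_sub, integral_sub, setIntegral_density (h _),
    setIntegral_density (h _), setIntegral_density (h _), mutualEnergyMeasure]
  · simp only [FunLike.coe_smul, FunLike.coe_sub, Pi.smul_apply, Pi.sub_apply,
      Measure.toSignedMeasure_apply_measurable hB, smul_eq_mul]
    ring
  · exact (integrable_density _ _).integrableOn
  · exact (integrable_density _ _).integrableOn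
  · exact ((integrable_density _ _).sub (integrable_density _ _)).integrableOn
  · exact (integrable_density _ _).integrableOn

theorem densityMatrix_isSymm (ν : Measure K) {N : ℕ} (f : Fin N → E.domain) (x : K) :
    (E.densityMatrix ν f x).IsSymm := by
  ext i j
  have h : E.mutualEnergyMeasure (f j) (f i) = E.mutualEnergyMeasure (f i) (f j) := by
    ext B hB
    simp only [mutualEnergyMeasure, FunLike.coe_smul, FunLike.coe_sub, Pi.smul_apply,
      Pi.sub_apply, Measure.toSignedMeasure_apply_measurable hB, smul_eq_mul, add_comm (f j)]
    ring
  simp only [densityMatrix, Matrix.transpose_apply, Matrix.of_apply, h]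

theorem measurable_densityMatrix (ν : Measure K) {N : ℕ} (f : Fin N → E.domain) :
    Measurable fun x => fun i j => E.densityMatrix ν f x i j :=
  measurable_pi_iff.mpr fun _ => measurable_pi_iff.mpr fun _ =>
    SignedMeasure.measurable_rnDeriv _ ν

theorem measurableSet_lt_rank (ν : Measure K) {N : ℕ} (f : Fin N → E.domain) (n : ℕ) :
    MeasurableSet {x | (n : ℕ∞) < ((E.densityMatrix ν f x).rank : ℕ∞)} := by
  have h : IsOpen {A : Fin N → Fin N → ℝ | n < (Matrix.of A).rank} := isOpen_lt_rank N n
  simp only [Nat.cast_lt]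
  exact measurable_densityMatrix ν f h.measurableSet

/-- For fixed B the mass ν_F(B) obeys the parallelogram law in F, so `quadratic_sum` expands it.
Since B is arbitrary, the densities agree almost everywhere. -/
theorem IsRegular.densityMatrix_quadratic (hE : E.IsRegular) {ν : Measure K} [SigmaFinite ν]
    (h : ∀ F : E.domain, E.energyMeasure F ≪ ν) {N : ℕ} (f : Fin N → E.domain) (a : Fin N → ℚ) :
    ∀ᵐ x ∂ν, ∑ i, ∑ j, (a i : ℝ) * a j * E.densityMatrix ν f x i j =
      E.density ν (∑ i, (a i : ℝ) • f i) x := by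
  let Z : Fin N → Fin N → K → ℝ := fun i j x =>
    (E.density ν (f i + f j) x - E.density ν (f i) x - E.density ν (f j) x) / 2
  have hZi : ∀ i j, Integrable (Z i j) ν := fun i j =>
    (((integrable_density ν (f i + f j)).sub (integrable_density ν (f i))).sub
      (integrable_density ν (f j))).div_const 2
  have hZ : ∀ᵐ x ∂ν, ∀ i j, E.densityMatrix ν f x i j = Z i j x :=
    ae_all_iff.mpr fun i => ae_all_iff.mpr fun j => rnDeriv_mutualEnergyMeasure h (f i) (f j)
  have hsi : ∀ i, Integrable (fun x => ∑ j, (a i : ℝ) * a j * Z i j x) ν := fun i =>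
    integrable_finsetSum _ fun j _ => (hZi i j).const_mul _
  have hint : Integrable (fun x => ∑ i, ∑ j, (a i : ℝ) * a j * Z i j x) ν :=
    integrable_finsetSum _ fun i _ => hsi i
  have hkey : (fun x => ∑ i, ∑ j, (a i : ℝ) * a j * Z i j x) =ᵐ[ν]
      E.density ν (∑ i, (a i : ℝ) • f i) := by
    refine Integrable.ae_eq_of_forall_setIntegral_eq _ _ hint (integrable_density _ _)
      fun B hB _ => ?_
    rw [setIntegral_density (h _), integral_finsetSum _ fun i _ => (hsi i).integrableOn]
    rw [quadratic_sum (fun F => (E.energyMeasure F).real B) (fun F G => by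
      have := hE.energyMeasure_parallelogram F G one_ne_zero hB
      simp only [inv_one, one_smul, one_pow] at this
      linarith) f a]
    refine Finset.sum_congr rfl fun i _ => ?_
    rw [integral_finsetSum _ fun j _ => ((hZi i j).const_mul _).integrableOn]
    refine Finset.sum_congr rfl fun j _ => ?_
    rw [integral_const_mul, integral_div, integral_sub, integral_sub, setIntegral_density (h _),
      setIntegral_density (h _), setIntegral_density (h _)]
    · exact (integrable_density _ _).integrableOn
    · exact (integrable_density _ _).integrableOn
    · exact ((integrable_density _ _).sub (integrable_density _ _)).integrableOn
    · exact (integrable_density _ _).integrableOn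
  filter_upwards [hZ, hkey] with x h1 h2
  rw [← h2]
  simp only [h1]

/-- If the energy measures of `E'` are dominated by those of `E`, so are the ranks. -/
theorem rank_densityMatrix_le (hE : E.IsRegular) (hE' : E'.IsRegular) {ν : Measure K}
    [SigmaFinite ν] (h : ∀ F : E.domain, E.energyMeasure F ≪ ν)
    (h' : ∀ F : E'.domain, E'.energyMeasure F ≪ ν) (T : E.domain ≃ₗ[ℝ] E'.domain) {c : ℝ}
    (hle : ∀ F B, MeasurableSet B →
      (E'.energyMeasure (T F)).real B ≤ c * (E.energyMeasure F).real B)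
    {N : ℕ} (f : Fin N → E.domain) :
    ∀ᵐ x ∂ν, (E'.densityMatrix ν (fun i => T (f i)) x).rank ≤ (E.densityMatrix ν f x).rank := by
  have hdens : ∀ F, E'.density ν (T F) ≤ᵐ[ν] fun x => c * E.density ν F x := fun F => by
    refine ae_le_of_forall_setIntegral_le (integrable_density _ _)
      ((integrable_density _ _).const_mul c) fun B hB _ => ?_
    rw [integral_const_mul, setIntegral_density (h _), setIntegral_density (h' _)]
    exact hle F B hB
  -- Rational vectors are countable, so one null set serves for all of them; real vectors follow by
  -- continuity at each remaining point.
  filter_upwards [ae_all_iff.mpr fun a : Fin N → ℚ => hE.densityMatrix_quadratic h f a,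
    ae_all_iff.mpr fun a : Fin N → ℚ => hE'.densityMatrix_quadratic h' (fun i => T (f i)) a,
    ae_all_iff.mpr fun a : Fin N → ℚ => hdens (∑ i, (a i : ℝ) • f i)] with x h1 h2 h3
  refine rank_le_rank_of_quadratic_le (C := c) (densityMatrix_isSymm ν _ x)
    (forall_real_of_forall_rat fun a => ?_) fun a => ?_
  · rw [h2 a]
    exact ENNReal.toReal_nonneg
  · have h4 := forall_real_of_forall_rat
      (A := c • E.densityMatrix ν f x - E'.densityMatrix ν (fun i => T (f i)) x) (fun a => by
        simp only [Matrix.sub_apply, Matrix.smul_apply, smul_eq_mul, mul_sub,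
          Finset.sum_sub_distrib, mul_left_comm _ c, ← Finset.mul_sum]
        rw [h1 a, h2 a]
        have h5 := h3 a
        simp only [map_sum, map_smul] at h5
        linarith) a
    simp only [Matrix.sub_apply, Matrix.smul_apply, smul_eq_mul, mul_sub,
          Finset.sum_sub_distrib, mul_left_comm _ c, ← Finset.mul_sum] at h4
    linarith

theorem BoundsRank.of_rank_le {ν : Measure K} (T : E.domain ≃ₗ[ℝ] E'.domain)
    (hle : ∀ (N : ℕ) (f : Fin N → E.domain), ∀ᵐ x ∂ν,
      (E'.densityMatrix ν (fun i => T (f i)) x).rank ≤ (E.densityMatrix ν f x).rank)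
    {p : K → ℕ∞} (hp : E.BoundsRank ν p) : E'.BoundsRank ν p := by
  intro N f
  filter_upwards [hp N fun i => T.symm (f i), hle N fun i => T.symm (f i)] with x h1 h2
  simp only [LinearEquiv.apply_symm_apply] at h2
  exact le_trans (by exact_mod_cast h2) h1

/-- Existence of the pointwise index. -/
theorem exists_isPointwiseIndex (E : DirichletForm μ) (ν : Measure K) [SigmaFinite ν] :
    ∃ p : K → ℕ∞, E.IsPointwiseIndex ν p := by
  obtain ⟨p, h1, h2, h3⟩ := exists_essential_iSup ν
    (fun (i : Σ N : ℕ, Fin N → E.domain) x => ((E.densityMatrix ν i.2 x).rank : ℕ∞))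
    fun i n => measurableSet_lt_rank ν i.2 n
  exact ⟨p, h1, fun N f => h2 ⟨N, f⟩, fun p' hp' => h3 p' fun i => hp' i.1 i.2⟩

end Density

end DirichletForm
end

/-! ### The proposition -/

open DirichletForm

theorem proposition2p11 {K : Type*} [TopologicalSpace K] [LocallyCompactSpace K]
    [TopologicalSpace.SeparableSpace K] [TopologicalSpace.MetrizableSpace K]
    [MeasurableSpace K] [BorelSpace K]
    (μ : Measure K) [SigmaFinite μ] [μ.IsOpenPosMeasure]
    (E E' : DirichletForm μ)
    (hE : E.IsRegular) (hE' : E'.IsRegular)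
    (hEloc : E.IsStrongLocal) (hEloc' : E'.IsStrongLocal)
    (hdom : E.domain = E'.domain)
    (c₁ c₂ : ℝ) (hc₁ : 0 < c₁) (hc₂ : 0 < c₂)
    (hcomp : ∀ (f : Lp ℝ 2 μ) (hf : f ∈ E.domain) (hf' : f ∈ E'.domain),
      c₁ * E.form ⟨f, hf⟩ ⟨f, hf⟩ ≤ E'.form ⟨f, hf'⟩ ⟨f, hf'⟩ ∧
        E'.form ⟨f, hf'⟩ ⟨f, hf'⟩ ≤ c₂ * E.form ⟨f, hf⟩ ⟨f, hf⟩)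
    (ν : Measure K) (hν : E.IsMinimalEnergyDominant ν) :
    E'.IsMinimalEnergyDominant ν ∧
      (∃ p : K → ℕ∞, E.IsPointwiseIndex ν p ∧ E'.IsPointwiseIndex ν p) ∧
      (∀ p p' : K → ℕ∞, E.IsPointwiseIndex ν p → E'.IsPointwiseIndex ν p' → p =ᵐ[ν] p') := by
  set T : E.domain ≃ₗ[ℝ] E'.domain := LinearEquiv.ofEq E.domain E'.domain hdom
  have hT : ∀ F, (T F : Lp ℝ 2 μ) = F := fun F => rfl
  have hT' : ∀ F, (T.symm F : Lp ℝ 2 μ) = F := fun F => rfl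
  have hle : ∀ F B, MeasurableSet B →
      (E'.energyMeasure (T F)).real B ≤ c₂ * (E.energyMeasure F).real B := fun F B hB =>
    energyMeasure_real_le hE hE' hEloc hEloc' hc₂.le T hT
      (fun F => (hcomp F F.2 (T F).2).2) F hB
  have hle' : ∀ F B, MeasurableSet B →
      (E.energyMeasure (T.symm F)).real B ≤ c₁⁻¹ * (E'.energyMeasure F).real B := fun F B hB =>
    energyMeasure_real_le hE' hE hEloc' hEloc (inv_pos.mpr hc₁).le T.symm hT'
      (fun F => (le_inv_mul_iff₀ hc₁).mpr (hcomp F (T.symm F).2 F.2).1) F hB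
  have := hν.sigmaFinite
  have hac : ∀ F : E.domain, E'.energyMeasure (T F) ≪ E.energyMeasure F := fun F => by
    refine Measure.AbsolutelyContinuous.mk fun B hB h0 => ?_
    have h1 := hle F B hB
    rw [measureReal_def (E.energyMeasure F), h0, ENNReal.toReal_zero, mul_zero] at h1
    exact (measureReal_eq_zero_iff).mp (le_antisymm h1 measureReal_nonneg)
  have hac' : ∀ F : E'.domain, E.energyMeasure (T.symm F) ≪ E'.energyMeasure F := fun F => by
    refine Measure.AbsolutelyContinuous.mk fun B hB h0 => ?_
    have h1 := hle' F B hB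
    rw [measureReal_def (E'.energyMeasure F), h0, ENNReal.toReal_zero, mul_zero] at h1
    exact (measureReal_eq_zero_iff).mp (le_antisymm h1 measureReal_nonneg)
  have hν' : E'.IsMinimalEnergyDominant ν :=
    ⟨hν.sigmaFinite, fun F => by
      simpa using (hac (T.symm F)).trans (hν.domination (T.symm F)),
      fun ν' hσ hdomin => hν.minimality ν' hσ fun F => by
        simpa using (hac' (T F)).trans (hdomin (T F))⟩
  have hbr : ∀ p : K → ℕ∞, E.BoundsRank ν p → E'.BoundsRank ν p := fun p hp =>
    hp.of_rank_le T fun N f => rank_densityMatrix_le hE hE' hν.domination hν'.domination T hle f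
  have hbr' : ∀ p : K → ℕ∞, E'.BoundsRank ν p → E.BoundsRank ν p := fun p hp =>
    hp.of_rank_le T.symm fun N f =>
      rank_densityMatrix_le hE' hE hν'.domination hν.domination T.symm hle' f
  -- Both forms have the same rank-bounding functions, so a smallest one for E is a smallest one for
  -- E'.
  have hindex : ∀ p : K → ℕ∞, E.IsPointwiseIndex ν p → E'.IsPointwiseIndex ν p := fun p hp =>
    ⟨hp.measurable, hbr p hp.boundsRank, fun p' hp' => hp.le_of_boundsRank p' (hbr' p' hp')⟩
  obtain ⟨p, hp⟩ := exists_isPointwiseIndex E ν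
  refine ⟨hν', ⟨p, hp, hindex p hp⟩, fun p p' hp hp' => ?_⟩
  filter_upwards [hp.le_of_boundsRank p' (hbr' p' hp'.boundsRank),
    hp'.le_of_boundsRank p (hbr p hp.boundsRank)] with x h1 h2
  exact le_antisymm h1 h2
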